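/- Let $n\ge 2$ and $m\ge 0$ be integers. Let $\mathcal E'(S^p)$ be the space of compactly supported (complex-valued) distributional symmetric $p$-tensor fields on $\mathbb R^n$, i.e. families $f=(f_{i_1\cdots i_p})$ of distributions $f_{i_1\cdots i_p}\in\mathcal E'(\mathbb R^n)$ symmetric in the indices, and let $\mathcal E'(\mathbf S^m)=\bigoplus_{p=0}^m\mathcal E'(S^p)$. For $F=\sum_{p=0}^m f^{(p)}\in\mathcal E'(\mathbf S^m)$ and an integer $k\ge 0$, let $J^{m,k}F$ be the $k$-th momentum ray transform of $F$ on the unit sphere bundle $\mathbb R^n\times\mathbb S^{n-1}$, that is, the distribution defined by $$\langle J^{m,k}F,\Psi\rangle=\sum_{p=0}^m\ \sum_{i_1,\dots,i_p=1}^n\Big\langle f^{(p)}_{i_1\cdots i_p},\ \int_{\mathbb S^{n-1}}\int_{\mathbb R}t^k\,\xi^{i_1}\cdots\xi^{i_p}\,\Psi(x-t\xi,\xi)\,dt\,dS(\xi)\Big\rangle,\qquad \Psi\in C_c^\infty(\mathbb R^n\times\mathbb S^{n-1});$$ for smooth compactly supported $F$ it is the function $J^{m,k}F(x,\xi)=\int_{\mathbb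 R}t^k\sum_{p=0}^m f^{(p)}_{i_1\cdots i_p}(x+t\xi)\,\xi^{i_1}\cdots\xi^{i_p}\,dt$ (summation over repeated indices), $|\xi|=1$. Let $i_\delta$ be the operator from symmetric $p$-tensor fields to symmetric $(p+2)$-tensor fields given by $(i_\delta f)_{i_1\cdots i_{p+2}}=\sigma(i_1\cdots i_{p+2})\,f_{i_1\cdots i_p}\delta_{i_{p+1}i_{p+2}}$, where $\sigma$ is symmetrization (averaging over all permutations of the indices), and let $i_\delta^j$ be its $j$-fold composition. Write $[\cdot]$ for the integer part. **Theorem.** Let $F=\sum_{p=0}^m f^{(p)}\in\mathcal E'(\mathbf S^m)$. 1. If $m\ge 2$, the following are equivalent: (a) $J^{m,m}F=0$ on $\mathbb R^n\times\mathbb S^{n-1}$; (b) $J^{m,k}F=0$ on $\mathbb R^n\times\mathbb S^{n-1}$ for all $k=0,1,\dots,m$; (c) $$f^{(2[\frac m2])}=-i_\delta\Big(\sum_{l=1}^{[\frac m2]}i_\delta^{[\frac m2]-l}f^{(2l-2)}\Big)\quad\text{and}\quad f^{(2[\frac{m-1}2]+1)}=-i_\delta\Big(\sum_{l=1}^{[\frac{m-1}2]}i_\delta^{[\frac{m-1}2]-l}f^{(2l-1)}\Big),$$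 where an empty sum is $0$. 2. If $m\in\{0,1\}$, then $J^{m,m}F=0$ on $\mathbb R^n\times\mathbb S^{n-1}$ if and only if $J^{m,k}F=0$ for all $0\le k\le m$, if and only if $F=0$. -/

import Mathlib

open MeasureTheory
open scoped ContDiff Convolution

noncomputable section

namespace MRT

/-- Euclidean space `ℝⁿ`. -/
abbrev Euc (n : ℕ) : Type := EuclideanSpace ℝ (Fin n)

/-- `C^∞(ℝⁿ)`: smooth complex-valued functions on `ℝⁿ`, with no support condition. -/
def Smooth (n : ℕ) : Submodule ℂ (Euc n → ℂ) where
  carrier := {φ | ContDiff ℝ ∞ φ}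
  add_mem' ha hb := ContDiff.add (𝕜 := ℝ) (n := ∞) ha hb
  zero_mem' := contDiff_const (𝕜 := ℝ) (n := ∞) (c := (0 : ℂ))
  smul_mem' c _ hf := ContDiff.const_smul (𝕜 := ℝ) (n := ∞) c hf

/-- `T` is continuous on `C^∞(ℝⁿ)` (uniform convergence of all derivatives on compact sets):
for some compact `K`, order `N` and constant `C`, one has
`|T φ| ≤ C sup_{x ∈ K, j ≤ N} ‖D^j φ(x)‖` for all `φ`; the supremum is replaced by its
arbitrary nonnegative upper bounds `B`. -/
def IsContinuousFunctional {n : ℕ} (T : Smooth n →ₗ[ℂ] ℂ) : Prop :=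
  ∃ (K : Set (Euc n)) (N : ℕ) (C : ℝ), IsCompact K ∧ 0 ≤ C ∧
    ∀ (φ : Smooth n) (B : ℝ), 0 ≤ B →
      (∀ j ≤ N, ∀ x ∈ K, ‖iteratedFDeriv ℝ j φ.1 x‖ ≤ B) → ‖T φ‖ ≤ C * B

/-- `ℰ'(ℝⁿ)`: compactly supported distributions, the continuous dual of `C^∞(ℝⁿ)`. -/
def CompactDistribution (n : ℕ) : Submodule ℂ (Smooth n →ₗ[ℂ] ℂ) where
  carrier := {T | IsContinuousFunctional T}
  zero_mem' := ⟨∅, 0, 0, isCompact_empty, le_rfl, fun φ B _ _ => by simp⟩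
  add_mem' := by
    rintro S T ⟨K, N, C, hK, hC, hS⟩ ⟨K', N', C', hK', hC', hT⟩
    refine ⟨K ∪ K', max N N', C + C', hK.union hK', add_nonneg hC hC', fun φ B hB h => ?_⟩
    have h1 := hS φ B hB fun j hj x hx => h j (hj.trans (le_max_left _ _)) x (Or.inl hx)
    have h2 := hT φ B hB fun j hj x hx => h j (hj.trans (le_max_right _ _)) x (Or.inr hx)
    calc ‖(S + T) φ‖ ≤ ‖S φ‖ + ‖T φ‖ := norm_add_le _ _
      _ ≤ (C + C') * B := by linarith
  smul_mem' := by
    rintro c T ⟨K, N, C, hK, hC, hT⟩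
    refine ⟨K, N, ‖c‖ * C, hK, by positivity, fun φ B hB h => ?_⟩
    have h1 := hT φ B hB h
    calc ‖(c • T) φ‖ = ‖c‖ * ‖T φ‖ := norm_smul c (T φ)
      _ ≤ ‖c‖ * (C * B) := by gcongr
      _ = ‖c‖ * C * B := by ring

/-- `ℰ'(S^p)`: compactly supported distributional symmetric `p`-tensor fields on `ℝⁿ`,
given by components `f_{i₁ … i_p} ∈ ℰ'(ℝⁿ)` invariant under permutation of the indices. -/
def SymTensor (n p : ℕ) : Submodule ℂ ((Fin p → Fin n) → CompactDistribution n) where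
  carrier := {f | ∀ (π : Equiv.Perm (Fin p)) (I : Fin p → Fin n), f (I ∘ π) = f I}
  zero_mem' _ _ := rfl
  add_mem' ha hb π I := by simp only [Pi.add_apply, ha π I, hb π I]
  smul_mem' c _ hf π I := by simp only [Pi.smul_apply, hf π I]

/-- `ℰ'(𝐒^m)`: the elements `F = ∑_{p=0}^m f^{(p)}` of `⨁_{p=0}^m ℰ'(S^p)`. -/
abbrev TensorSum (n m : ℕ) : Type := (p : Fin (m + 1)) → SymTensor n p

/-- `(i_δ f)_{i₁ … i_{p+2}} = σ(i₁ … i_{p+2}) f_{i₁ … i_p} δ_{i_{p+1} i_{p+2}}`, with `σ` the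
symmetrization (the average over all permutations of the indices). -/
def iDelta {n p : ℕ} (f : SymTensor n p) : SymTensor n (p + 2) :=
  ⟨fun I => ((p + 2).factorial : ℂ)⁻¹ • ∑ π : Equiv.Perm (Fin (p + 2)),
      if I (π (Fin.natAdd p 0)) = I (π (Fin.natAdd p 1)) then
        f.1 (fun j => I (π (Fin.castAdd 2 j))) else 0, by
    intro τ I
    dsimp only
    congr 1
    exact Fintype.sum_equiv (Equiv.mulLeft τ) _ _ fun π => rfl⟩

/-- `i_δ^j`, which raises the rank by `2 j`. -/
def iDeltaPow {n p : ℕ} : (j : ℕ) → SymTensor n p → SymTensor n (p + 2 * j)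
  | 0, f => f
  | j + 1, f => iDelta (iDeltaPow j f)

/-- `i_δ^j` with the rank `p + 2 j` of the result written as `q`. -/
def iDeltaPowTo {n p q : ℕ} (j : ℕ) (h : p + 2 * j = q) (f : SymTensor n p) : SymTensor n q :=
  h ▸ iDeltaPow j f

/-- `C_c^∞(ℝⁿ × (ℝⁿ ∖ {0}))`. The restrictions of these functions to `ℝⁿ × 𝕊^{n-1}` are exactly
the elements of `C_c^∞(ℝⁿ × 𝕊^{n-1})`. -/
structure TestFunction (n : ℕ) where
  toFun : Euc n × Euc n → ℂ
  smooth : ContDiff ℝ ∞ toFun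
  compact : HasCompactSupport toFun
  support_ne : ∀ q ∈ tsupport toFun, q.2 ≠ 0

/-- The integrand `t^k ξ^{i₁} ⋯ ξ^{i_p} Ψ(x - t ξ, ξ)`. -/
def adjointIntegrand {n p : ℕ} (k : ℕ) (Ψ : TestFunction n) (I : Fin p → Fin n)
    (x ξ : Euc n) (t : ℝ) : ℂ :=
  (t : ℂ) ^ k * (∏ j, (ξ (I j) : ℂ)) * Ψ.toFun (x - t • ξ, ξ)

theorem adjointIntegrand_contDiff {n p : ℕ} (k : ℕ) (Ψ : TestFunction n) (I : Fin p → Fin n) :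
    ContDiff ℝ ∞ (fun q : Euc n × (Euc n × ℝ) => adjointIntegrand k Ψ I q.1 q.2.1 q.2.2) := by
  have hc : ContDiff ℝ ∞ (fun r : ℝ => (r : ℂ)) := Complex.ofRealCLM.contDiff
  have h1 : ContDiff ℝ ∞ (fun q : Euc n × (Euc n × ℝ) => ((q.2.2 : ℝ) : ℂ)) :=
    hc.comp (contDiff_snd.comp contDiff_snd)
  have h2 : ∀ i, ContDiff ℝ ∞ (fun q : Euc n × (Euc n × ℝ) => ((q.2.1 i : ℝ) : ℂ)) := fun i =>
    hc.comp ((EuclideanSpace.proj i : Euc n →L[ℝ] ℝ).contDiff.comp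
      (contDiff_fst.comp contDiff_snd))
  have h3 : ContDiff ℝ ∞ (fun q : Euc n × (Euc n × ℝ) => (q.1 - q.2.2 • q.2.1, q.2.1)) := by
    fun_prop
  exact ((h1.pow k).mul (contDiff_prod fun j _ => h2 (I j))).mul (Ψ.smooth.comp h3)

theorem adjointIntegrand_support {n p : ℕ} (k : ℕ) (Ψ : TestFunction n) (I : Fin p → Fin n)
    (r : ℝ) : ∃ A : Set (Euc n × ℝ), IsCompact A ∧
      ∀ x, ‖x‖ < r → ∀ q, q ∉ A → adjointIntegrand k Ψ I x q.1 q.2 = 0 := by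
  have hK : IsCompact (tsupport Ψ.toFun) := Ψ.compact
  obtain ⟨R, hR⟩ := hK.isBounded.exists_norm_le
  obtain ⟨c, hc, hcK⟩ : ∃ c : ℝ, 0 < c ∧ ∀ q ∈ tsupport Ψ.toFun, c ≤ ‖q.2‖ := by
    rcases (tsupport Ψ.toFun).eq_empty_or_nonempty with h | h
    · exact ⟨1, one_pos, by simp [h]⟩
    · obtain ⟨q, hq, hmin⟩ := hK.exists_isMinOn h
        (f := fun q : Euc n × Euc n => ‖q.2‖) (by fun_prop)
      exact ⟨‖q.2‖, norm_pos_iff.2 (Ψ.support_ne q hq), fun y hy => hmin hy⟩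
  refine ⟨Metric.closedBall 0 R ×ˢ Metric.closedBall 0 ((R + r) / c),
    (isCompact_closedBall _ _).prod (isCompact_closedBall _ _), fun x hx q hq => ?_⟩
  by_contra hne
  apply hq
  have hΨ : Ψ.toFun (x - q.2 • q.1, q.1) ≠ 0 := fun h0 => hne (by simp [adjointIntegrand, h0])
  have hmem : (x - q.2 • q.1, q.1) ∈ tsupport Ψ.toFun := subset_tsupport _ hΨ
  have h1 := hR _ hmem
  have h2 := hcK _ hmem
  rw [Prod.norm_def, max_le_iff] at h1
  simp only at h1 h2
  refine ⟨by simpa using h1.2, ?_⟩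
  rw [mem_closedBall_zero_iff, le_div_iff₀ hc]
  have h3 : ‖q.2 • q.1‖ ≤ R + r := by
    have : q.2 • q.1 = x - (x - q.2 • q.1) := by abel
    rw [this]
    linarith [norm_sub_le x (x - q.2 • q.1), h1.1]
  rw [norm_smul] at h3
  exact (mul_le_mul_of_nonneg_left h2 (norm_nonneg _)).trans h3

theorem adjoint_contDiff {n p : ℕ} (ν : Measure (Euc n)) [IsFiniteMeasureOnCompacts ν]
    [SFinite ν] (k : ℕ) (Ψ : TestFunction n) (I : Fin p → Fin n) :
    ContDiff ℝ ∞ (fun x => ∫ ξ, ∫ t, adjointIntegrand k Ψ I x ξ t ∂volume ∂ν) := by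
  have hprod : ∀ x, ∫ ξ, ∫ t, adjointIntegrand k Ψ I x ξ t ∂volume ∂ν =
      ∫ q, adjointIntegrand k Ψ I x q.1 q.2 ∂(ν.prod volume) := by
    intro x
    obtain ⟨A, hA, hA0⟩ := adjointIntegrand_support k Ψ I (‖x‖ + 1)
    have hcont : Continuous (fun q : Euc n × ℝ => adjointIntegrand k Ψ I x q.1 q.2) :=
      (adjointIntegrand_contDiff k Ψ I).continuous.comp
        (Continuous.prodMk continuous_const continuous_id)
    refine (integral_prod _ (hcont.integrable_of_hasCompactSupport ?_)).symm
    exact HasCompactSupport.intro hA fun q hq => hA0 x (by linarith) q hq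
  simp only [hprod]
  rw [contDiff_iff_contDiffAt]
  intro x₀
  obtain ⟨A, hA, hA0⟩ := adjointIntegrand_support k Ψ I (‖x₀‖ + 1)
  let g : Euc n → Euc n × ℝ → ℂ := fun x q => adjointIntegrand k Ψ I x (-q).1 (-q).2
  have hconv := contDiffOn_convolution_right_with_param (𝕜 := ℝ) (μ := ν.prod volume)
    (f := fun _ => (1 : ℝ)) (n := ⊤) (ContinuousLinearMap.lsmul ℝ ℝ) (g := g)
    (s := Metric.ball 0 (‖x₀‖ + 1)) (k := -A) Metric.isOpen_ball hA.neg
    (fun x q hx hq => hA0 x (by simpa using hx) (-q) (by simpa using hq))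
    (locallyIntegrable_const _)
    (((adjointIntegrand_contDiff k Ψ I).comp
      (g := fun q : Euc n × (Euc n × ℝ) =>
        adjointIntegrand k Ψ I q.1 q.2.1 q.2.2)
      (f := fun q : Euc n × (Euc n × ℝ) => (q.1, -q.2)) (by fun_prop)).contDiffOn)
  have hat := (hconv.contDiffAt (x := (x₀, 0)) (by
    apply (Metric.isOpen_ball.prod isOpen_univ).mem_nhds
    simp)).comp x₀ (f := fun x : Euc n => (x, (0 : Euc n × ℝ))) (by fun_prop)
  refine hat.congr_of_eventuallyEq (Filter.Eventually.of_forall fun x => ?_)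
  simp [convolution, g]

/-- The component `i₁ … i_p` of the adjoint momentum ray transform of `Ψ`, the smooth function
`x ↦ ∫_{ℝⁿ} ∫_ℝ t^k ξ^{i₁} ⋯ ξ^{i_p} Ψ(x - t ξ, ξ) dt dν(ξ)`. -/
def momentAdjoint {n p : ℕ} (ν : Measure (Euc n)) [IsFiniteMeasureOnCompacts ν] [SFinite ν]
    (k : ℕ) (Ψ : TestFunction n) (I : Fin p → Fin n) : Smooth n :=
  ⟨fun x => ∫ ξ, ∫ t, adjointIntegrand k Ψ I x ξ t ∂volume ∂ν, adjoint_contDiff ν k Ψ I⟩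

/-- The `k`-th momentum ray transform of `F ∈ ℰ'(𝐒^m)`, as a distribution in `(x, ξ)` with
respect to the measure `dx dν(ξ)`:
`Ψ ↦ ∑_{p=0}^m ∑_{i₁, …, i_p} ⟨f^{(p)}_{i₁ … i_p}, (adjoint transform of Ψ)_{i₁ … i_p}⟩`.
For `ν` the Lebesgue measure this is `I^{m,k} F`. -/
def momentRayTransform {n m : ℕ} (ν : Measure (Euc n)) [IsFiniteMeasureOnCompacts ν] [SFinite ν]
    (k : ℕ) (F : TensorSum n m) (Ψ : TestFunction n) : ℂ :=
  ∑ p : Fin (m + 1), ∑ I : Fin p → Fin n, ((F p).1 I).1 (momentAdjoint ν k Ψ I)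

/-- The surface measure of `𝕊^{n-1}`, as a measure on `ℝⁿ`. -/
def sphereMeasure (n : ℕ) : Measure (Euc n) :=
  (volume : Measure (Euc n)).toSphere.map Subtype.val

instance (n : ℕ) : IsFiniteMeasure (sphereMeasure n) := by
  unfold sphereMeasure
  infer_instance

/-- `J^{m,k} F`, the restriction of `I^{m,k} F` to `ℝⁿ × 𝕊^{n-1}`, as a distribution on the
unit sphere bundle: test functions are paired with `dx dS(ξ)`. -/
def sphereTransform {n m : ℕ} (k : ℕ) (F : TensorSum n m) : TestFunction n → ℂ :=
  momentRayTransform (sphereMeasure n) k F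

/-- `f^{(2M)} = - ∑_{l=1}^{M} i_δ^{M-l+1} f^{(2l-2)}` with `M = [m/2]`
(the summation index is shifted by one). -/
def EvenRelation {n m : ℕ} (F : TensorSum n m) : Prop :=
  F ⟨2 * (m / 2), by omega⟩ =
    -∑ l : Fin (m / 2), iDeltaPowTo (m / 2 - l) (by simp only; omega) (F ⟨2 * l, by omega⟩)

/-- `f^{(2M+1)} = - ∑_{l=1}^{M} i_δ^{M-l+1} f^{(2l-1)}` with `M = [(m-1)/2]`
(the summation index is shifted by one). -/
def OddRelation {n m : ℕ} (hm : 1 ≤ m) (F : TensorSum n m) : Prop :=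
  F ⟨2 * ((m - 1) / 2) + 1, by omega⟩ =
    -∑ l : Fin ((m - 1) / 2),
      iDeltaPowTo ((m - 1) / 2 - l) (by simp only; omega) (F ⟨2 * l + 1, by omega⟩)

end MRT

end

noncomputable section

namespace MRT

open scoped FourierTransform

/-! Since |ξ| = 1, contracting `i_δ f` with powers of ξ gives the same as contracting f
(`tensorPairing_iDelta`). Hence F has the same transforms as e + o, where e and o collect the
components of even and odd rank, each raised by `i_δ` to the largest rank of its parity not
exceeding m. Condition (c) says e = o = 0, so it gives the vanishing of every transform; the content
is that `J^{m,m} F = 0` forces e = o = 0.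

For this, F is tested against α(ξ) ρ(x ⬝ ξ) times a cut-off plane wave in the part of x orthogonal
to ξ. Along a line only ρ varies, so the ray integral is a convolution of t^m with ρ, and suitable
moments of ρ turn it into (x ⬝ ξ)^k for any k ≤ m (`exists_bump_convolution_pow`). Localising in ξ
gives, for |ξ| = 1 and y ⊥ ξ, that the contraction of e + o with powers of ξ annihilates (x ⬝ ξ)^k
exp(i x ⬝ y). Replacing ξ by -ξ gives opposite signs for e and o, so each satisfies this separately.

It remains to treat one field f of rank p ≤ m (`symTensor_eq_zero_of_rayWave`). Fix y ≠ 0 and a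
nonzero η ⊥ y, and put ξ = η + u y. Then y = s ξ + ζ with ζ ⊥ ξ and s = O(u). Expanding exp(i s x ⬝
ξ) to order m, the terms of order at most m are annihilated, so the contraction of the Fourier
transform of f at y with ξ is O(u^(m+1)). It is also a polynomial in u of degree at most p ≤ m,
hence zero. By continuity the form vanishes for all ξ, so the Fourier transform of f vanishes at
every y ≠ 0, then everywhere, and f = 0. -/

/-! ### Compactly supported distributions as functionals on jets -/

/-- The space of `j`-th derivatives, with the topology of its norm. -/
def Derivatives (n j : ℕ) : Type := Euc n [×j]→L[ℝ] ℂ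

instance (n j : ℕ) : NormedAddCommGroup (Derivatives n j) :=
  inferInstanceAs (NormedAddCommGroup (Euc n [×j]→L[ℝ] ℂ))

instance (n j : ℕ) : NormedSpace ℂ (Derivatives n j) :=
  inferInstanceAs (NormedSpace ℂ (Euc n [×j]→L[ℝ] ℂ))

instance (n j : ℕ) : CompleteSpace (Derivatives n j) :=
  inferInstanceAs (CompleteSpace (Euc n [×j]→L[ℝ] ℂ))

/-- Evaluation of a derivative at a tuple of vectors. -/
def evalDerivatives {n j : ℕ} (v : Fin j → Euc n) : Derivatives n j →L[ℂ] ℂ :=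
  LinearMap.mkContinuous
    { toFun := fun D : Euc n [×j]→L[ℝ] ℂ => D v
      map_add' := fun _ _ => rfl
      map_smul' := fun _ _ => rfl } (∏ i, ‖v i‖)
    fun D => (ContinuousMultilinearMap.le_opNorm (D : Euc n [×j]→L[ℝ] ℂ) v).trans_eq
      (mul_comm _ _)

/-- Jets of order `N` over `K`: the Banach space in which `C^N(K)` sits. -/
abbrev JetSpace (n : ℕ) (K : Set (Euc n)) (N : ℕ) : Type :=
  (j : Fin (N + 1)) → C(K, Derivatives n j)

theorem continuous_iteratedFDeriv {n : ℕ} (φ : Smooth n) (j : ℕ) :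
    Continuous (iteratedFDeriv ℝ j φ.1) :=
  ContDiff.continuous_iteratedFDeriv (n := ∞) (by exact_mod_cast le_top) φ.2

theorem contDiffAt_of_smooth {n : ℕ} (φ : Smooth n) (j : ℕ) (x : Euc n) :
    ContDiffAt ℝ j φ.1 x :=
  (ContDiff.of_le (n := ∞) φ.2 (by exact_mod_cast le_top)).contDiffAt

/-- The jet of a smooth function. -/
def jet {n : ℕ} (K : Set (Euc n)) (N : ℕ) : Smooth n →ₗ[ℂ] JetSpace n K N where
  toFun φ j := ⟨fun x => iteratedFDeriv ℝ j φ.1 x,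
    (continuous_iteratedFDeriv φ j).comp continuous_subtype_val⟩
  map_add' φ ψ := by
    funext j; ext1 x
    exact iteratedFDeriv_add_apply (contDiffAt_of_smooth φ j x) (contDiffAt_of_smooth ψ j x)
  map_smul' c φ := by
    funext j; ext1 x
    exact iteratedFDeriv_const_smul_apply (contDiffAt_of_smooth φ j x)

/-- A compactly supported distribution is a continuous functional of the jets over a compact
set. -/
theorem exists_jet_functional {n : ℕ} (T : CompactDistribution n) :
    ∃ (K : Set (Euc n)) (N : ℕ) (_ : CompactSpace K) (S : JetSpace n K N →L[ℂ] ℂ),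
      ∀ φ, T.1 φ = S (jet K N φ) := by
  obtain ⟨K, N, C, hK, hC, hT⟩ := T.2
  have hKc : CompactSpace K := isCompact_iff_compactSpace.1 hK
  have hb : ∀ φ, ‖T.1 φ‖ ≤ C * ‖jet K N φ‖ := by
    intro φ
    refine hT φ _ (norm_nonneg _) fun j hj x hx => ?_
    exact ((jet K N φ ⟨j, by omega⟩).norm_coe_le_norm ⟨x, hx⟩).trans
      (norm_le_pi_norm (jet K N φ) ⟨j, by omega⟩)
  have hker : LinearMap.ker (jet K N) ≤ LinearMap.ker T.1 := by
    intro φ hφ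
    have := hb φ
    rw [LinearMap.mem_ker.1 hφ, norm_zero, mul_zero] at this
    exact norm_le_zero_iff.1 this
  -- The functional descends to the range of the jet map, where it is bounded by `C`; Hahn–Banach
  -- then extends it to all of the Banach space of jets.
  let g : LinearMap.range (jet (n := n) K N) →ₗ[ℂ] ℂ :=
    ((LinearMap.ker (jet K N)).liftQ T.1 hker) ∘ₗ (jet K N).quotKerEquivRange.symm.toLinearMap
  have hg : ∀ φ, g ⟨jet K N φ, ⟨φ, rfl⟩⟩ = T.1 φ := by
    intro φ
    have : (jet K N).quotKerEquivRange.symm ⟨jet K N φ, ⟨φ, rfl⟩⟩ =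
        (LinearMap.ker (jet K N)).mkQ φ :=
      LinearMap.quotKerEquivRange_symm_apply_image _ _ _
    simp [g, this]
  let g' : StrongDual ℂ (LinearMap.range (jet (n := n) K N)) := g.mkContinuous C (by
    intro x
    obtain ⟨φ, hφ⟩ := x.2
    have hx : x = ⟨jet K N φ, ⟨φ, rfl⟩⟩ := Subtype.ext hφ.symm
    rw [hx, hg]
    exact hb φ)
  obtain ⟨S, hS, -⟩ := exists_extension_norm_eq _ g'
  refine ⟨K, N, hKc, S, fun φ => ?_⟩
  rw [← hg φ]
  exact (hS ⟨jet K N φ, ⟨φ, rfl⟩⟩).symm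

/-- Currying turns joint continuity into continuity for the compact-open topology, which on the
compact `K` is that of the sup norm. -/
theorem continuous_jet {n : ℕ} {Y : Type*} [TopologicalSpace Y] {Φ : Y → Smooth n}
    (hc : ∀ j, Continuous fun q : Y × Euc n => iteratedFDeriv ℝ j (Φ q.1).1 q.2)
    (K : Set (Euc n)) (N : ℕ) [CompactSpace K] : Continuous fun y => jet K N (Φ y) := by
  refine continuous_pi fun j => ?_
  have h : Continuous fun q : Y × K => (q.1, (q.2 : Euc n)) := by fun_prop
  let G : C(Y × K, Derivatives n j) :=
    ⟨fun q => iteratedFDeriv ℝ j (Φ q.1).1 q.2, (hc j).comp h⟩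
  exact G.curry.continuous

theorem continuous_pairing {n : ℕ} (T : CompactDistribution n) {Y : Type*} [TopologicalSpace Y]
    {Φ : Y → Smooth n}
    (hc : ∀ j, Continuous fun q : Y × Euc n => iteratedFDeriv ℝ j (Φ q.1).1 q.2) :
    Continuous fun y => T.1 (Φ y) := by
  obtain ⟨K, N, _, S, hS⟩ := exists_jet_functional T
  simp only [hS]
  exact S.continuous.comp (continuous_jet hc K N)

/-- Differentiation under the integral sign, to all orders. -/
theorem iteratedFDeriv_integral_apply {n : ℕ} {Y : Type*} [TopologicalSpace Y]
    [SecondCountableTopology Y] [MeasurableSpace Y] [OpensMeasurableSpace Y] (ν : Measure Y)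
    {Φ : Y → Smooth n}
    (hc : ∀ j, Continuous fun q : Y × Euc n => iteratedFDeriv ℝ j (Φ q.1).1 q.2)
    (hb : ∀ (R : ℝ) (j : ℕ), ∃ b : Y → ℝ, Integrable b ν ∧
      ∀ y x, ‖x‖ ≤ R → ‖iteratedFDeriv ℝ j (Φ y).1 x‖ ≤ b y)
    (φ : Smooth n) (hφ : ∀ x, φ.1 x = ∫ y, (Φ y).1 x ∂ν) (j : ℕ) (x : Euc n)
    (v : Fin j → Euc n) :
    iteratedFDeriv ℝ j φ.1 x v = ∫ y, iteratedFDeriv ℝ j (Φ y).1 x v ∂ν := by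
  have hcv : ∀ j (v : Fin j → Euc n),
      Continuous fun q : Y × Euc n => iteratedFDeriv ℝ j (Φ q.1).1 q.2 v := fun j v =>
    (ContinuousMultilinearMap.apply ℝ (fun _ : Fin j => Euc n) ℂ v).continuous.comp (hc j)
  have hmeas : ∀ j (v : Fin j → Euc n) x,
      AEStronglyMeasurable (fun y => iteratedFDeriv ℝ j (Φ y).1 x v) ν := fun j v x =>
    ((hcv j v).comp (by fun_prop : Continuous fun y : Y => (y, x))).aestronglyMeasurable
  have hint : ∀ j (v : Fin j → Euc n) x,
      Integrable (fun y => iteratedFDeriv ℝ j (Φ y).1 x v) ν := by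
    intro j v x
    obtain ⟨b, hbi, hbb⟩ := hb ‖x‖ j
    refine (hbi.mul_const (∏ i, ‖v i‖)).mono' (hmeas j v x)
      (Filter.Eventually.of_forall fun y => ?_)
    exact (ContinuousMultilinearMap.le_opNorm _ v).trans (by gcongr; exact hbb y x le_rfl)
  have hdiff : ∀ (ψ : Smooth n) (j : ℕ) (v : Fin j → Euc n) (z : Euc n),
      HasFDerivAt (fun z => iteratedFDeriv ℝ j ψ.1 z v)
        ((ContinuousMultilinearMap.apply ℝ (fun _ : Fin j => Euc n) ℂ v).comp
          (fderiv ℝ (iteratedFDeriv ℝ j ψ.1) z)) z := fun ψ j v z =>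
    (ContinuousMultilinearMap.apply ℝ (fun _ : Fin j => Euc n) ℂ v).hasFDerivAt.comp z
      ((ContDiff.differentiable_iteratedFDeriv (n := ∞)
        (by exact_mod_cast ENat.natCast_lt_top j) ψ.2) z).hasFDerivAt
  induction j generalizing x with
  | zero => simpa using hφ x
  | succ j ih =>
    -- The slot `v 0` is the new direction of differentiation; the slots `w` stay frozen, so a
    -- single derivative under the integral suffices.
    set w := Fin.tail v
    have hfun : (fun z => iteratedFDeriv ℝ j φ.1 z w) =
        fun z => ∫ y, iteratedFDeriv ℝ j (Φ y).1 z w ∂ν := funext fun z => ih z w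
    have hnorm : ∀ y z, ‖(ContinuousMultilinearMap.apply ℝ (fun _ : Fin j => Euc n) ℂ w).comp
        (fderiv ℝ (iteratedFDeriv ℝ j (Φ y).1) z)‖ ≤
          ‖iteratedFDeriv ℝ (j + 1) (Φ y).1 z‖ * ∏ i, ‖w i‖ := by
      intro y z
      refine ContinuousLinearMap.opNorm_le_bound _ (by positivity) fun h => ?_
      have := ContinuousMultilinearMap.le_opNorm (iteratedFDeriv ℝ (j + 1) (Φ y).1 z)
        (Fin.cons h w)
      rw [iteratedFDeriv_succ_apply_left, Fin.prod_univ_succ] at this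
      simp only [Fin.cons_zero, Fin.tail_cons, Fin.cons_succ] at this
      exact this.trans_eq (by ring)
    have hmeas' : AEStronglyMeasurable (fun y =>
        (ContinuousMultilinearMap.apply ℝ (fun _ : Fin j => Euc n) ℂ w).comp
          (fderiv ℝ (iteratedFDeriv ℝ j (Φ y).1) x)) ν := by
      refine Continuous.aestronglyMeasurable (continuous_clm_apply.2 fun h => ?_)
      have := (hcv (j + 1) (Fin.cons h w)).comp (by fun_prop : Continuous fun y : Y => (y, x))
      simp only [Function.comp_def, iteratedFDeriv_succ_apply_left, Fin.cons_zero,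
        Fin.tail_cons] at this
      exact this
    obtain ⟨b, hbi, hbb⟩ := hb (‖x‖ + 1) (j + 1)
    have hbb' : ∀ y, ∀ z ∈ Metric.ball x 1,
        ‖(ContinuousMultilinearMap.apply ℝ (fun _ : Fin j => Euc n) ℂ w).comp
          (fderiv ℝ (iteratedFDeriv ℝ j (Φ y).1) z)‖ ≤ b y * ∏ i, ‖w i‖ := by
      intro y z hz
      refine (hnorm y z).trans ?_
      gcongr
      refine hbb y z ?_
      have := norm_sub_norm_le z x
      rw [Metric.mem_ball, dist_eq_norm] at hz
      linarith
    have hder : HasFDerivAt (fun z => ∫ y, iteratedFDeriv ℝ j (Φ y).1 z w ∂ν)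
        (∫ y, (ContinuousMultilinearMap.apply ℝ (fun _ : Fin j => Euc n) ℂ w).comp
          (fderiv ℝ (iteratedFDeriv ℝ j (Φ y).1) x) ∂ν) x :=
      hasFDerivAt_integral_of_dominated_of_fderiv_le (bound := fun y => b y * ∏ i, ‖w i‖)
        (Metric.ball_mem_nhds x one_pos) (Filter.Eventually.of_forall (hmeas j w)) (hint j w x)
        hmeas' (Filter.Eventually.of_forall hbb') (hbi.mul_const _)
        (Filter.Eventually.of_forall fun y z _ => hdiff (Φ y) j w z)
    rw [← hfun] at hder
    have huniq := (hdiff φ j w x).unique hder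
    have hi : Integrable (fun y =>
        (ContinuousMultilinearMap.apply ℝ (fun _ : Fin j => Euc n) ℂ w).comp
          (fderiv ℝ (iteratedFDeriv ℝ j (Φ y).1) x)) ν :=
      (hbi.mul_const (∏ i, ‖w i‖)).mono' hmeas' (Filter.Eventually.of_forall fun y =>
        hbb' y x (Metric.mem_ball_self one_pos))
    have := congrArg (fun L : Euc n →L[ℝ] ℂ => L (v 0)) huniq
    simp only [ContinuousLinearMap.integral_apply hi] at this
    simp only [iteratedFDeriv_succ_apply_left]
    exact this

/-- A compactly supported distribution commutes with integrals of smooth functions depending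
on a parameter. -/
theorem pairing_integral {n : ℕ} (T : CompactDistribution n) {Y : Type*} [TopologicalSpace Y]
    [SecondCountableTopology Y] [MeasurableSpace Y] [OpensMeasurableSpace Y] (ν : Measure Y)
    {Φ : Y → Smooth n}
    (hc : ∀ j, Continuous fun q : Y × Euc n => iteratedFDeriv ℝ j (Φ q.1).1 q.2)
    (hb : ∀ (R : ℝ) (j : ℕ), ∃ b : Y → ℝ, Integrable b ν ∧
      ∀ y x, ‖x‖ ≤ R → ‖iteratedFDeriv ℝ j (Φ y).1 x‖ ≤ b y)
    (φ : Smooth n) (hφ : ∀ x, φ.1 x = ∫ y, (Φ y).1 x ∂ν) :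
    T.1 φ = ∫ y, T.1 (Φ y) ∂ν := by
  obtain ⟨K, N, hK, S, hS⟩ := exists_jet_functional T
  obtain ⟨R, hR⟩ := (isCompact_iff_compactSpace.2 hK).isBounded.exists_norm_le
  choose b hbi hbb using hb R
  have hint : ∀ j : Fin (N + 1), Integrable (fun y => jet K N (Φ y) j) ν := by
    intro j
    have hcj : Continuous fun y => jet K N (Φ y) j :=
      (continuous_apply j).comp (continuous_jet hc K N)
    refine (hbi j).norm.mono' hcj.aestronglyMeasurable (Filter.Eventually.of_forall fun y => ?_)
    refine (ContinuousMap.norm_le _ (norm_nonneg _)).2 fun x => ?_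
    exact (hbb j y x (hR x x.2)).trans (Real.le_norm_self _)
  have hjint : Integrable (fun y => jet K N (Φ y)) ν := Integrable.of_eval hint
  simp only [hS]
  rw [S.integral_comp_comm hjint]
  congr 1
  -- The functional commutes with the Bochner integral of jets; that this integral is the jet of `φ`
  -- is checked at each point and on each tuple of vectors.
  funext j
  rw [eval_integral hint]
  ext1 x
  rw [ContinuousMap.integral_apply (hint j) x]
  refine ContinuousMultilinearMap.ext fun v => ?_
  have hix : Integrable (fun y => jet K N (Φ y) j x) ν :=
    (ContinuousMap.evalCLM ℂ x).integrable_comp (hint j)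
  exact (iteratedFDeriv_integral_apply ν hc hb φ hφ j x v).trans
    ((evalDerivatives v).integral_comp_comm hix)

/-- Compactly supported distributions are local. -/
theorem exists_pairing_eq_of_eqOn_ball {n : ℕ} (T : CompactDistribution n) :
    ∃ R : ℝ, ∀ φ ψ : Smooth n, (∀ x, ‖x‖ < R → φ.1 x = ψ.1 x) → T.1 φ = T.1 ψ := by
  obtain ⟨K, N, hK, S, hS⟩ := exists_jet_functional T
  obtain ⟨R, hR⟩ := (isCompact_iff_compactSpace.2 hK).isBounded.exists_norm_le
  -- The margin 1 makes the open ball a neighbourhood of every point of `K`, so that all derivatives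
  -- agree on `K`.
  refine ⟨R + 1, fun φ ψ h => ?_⟩
  rw [hS, hS]
  congr 1
  funext j
  ext1 x
  refine (Filter.EventuallyEq.iteratedFDeriv (𝕜 := ℝ) ?_ j).eq_of_nhds
  have hx : (x : Euc n) ∈ Metric.ball (0 : Euc n) (R + 1) := by
    have := hR x x.2
    rw [mem_ball_zero_iff]
    linarith
  filter_upwards [Metric.isOpen_ball.mem_nhds hx] with z hz
  exact h z (by simpa using hz)

/-! ### Smooth families of test functions -/

/-- The smooth function `x ↦ Φ (y, x)`. -/
def slice {n : ℕ} {V : Type*} [NormedAddCommGroup V] [NormedSpace ℝ V] {Φ : V × Euc n → ℂ}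
    (hΦ : ContDiff ℝ ∞ Φ) (y : V) : Smooth n :=
  ⟨fun x => Φ (y, x), hΦ.comp (contDiff_const.prodMk contDiff_id)⟩

/-- The derivatives in x alone are the full derivatives of `Φ` restricted to the second factor, and
these are jointly continuous. -/
theorem continuous_iteratedFDeriv_slice {n : ℕ} {V : Type*} [NormedAddCommGroup V]
    [NormedSpace ℝ V] {Φ : V × Euc n → ℂ} (hΦ : ContDiff ℝ ∞ Φ) (j : ℕ) :
    Continuous fun q : V × Euc n => iteratedFDeriv ℝ j (slice hΦ q.1).1 q.2 := by
  have h : ∀ q : V × Euc n, iteratedFDeriv ℝ j (slice hΦ q.1).1 q.2 =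
      (iteratedFDeriv ℝ j Φ q).compContinuousLinearMap
        (fun _ => ContinuousLinearMap.inr ℝ V (Euc n)) := by
    intro q
    have h1 : (slice hΦ q.1).1 = (fun z => Φ (z + (q.1, 0))) ∘
        ContinuousLinearMap.inr ℝ V (Euc n) := by
      funext x
      simp [slice]
    have h2 : ContDiff ℝ ∞ fun z => Φ (z + (q.1, 0)) :=
      hΦ.comp (contDiff_id.add contDiff_const)
    rw [h1, ContinuousLinearMap.iteratedFDeriv_comp_right _ h2 _ (by exact_mod_cast le_top),
      iteratedFDeriv_comp_add_right]
    simp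
  simp only [h]
  exact (ContinuousMultilinearMap.compContinuousLinearMapL
    (fun _ : Fin j => ContinuousLinearMap.inr ℝ V (Euc n))).continuous.comp
    (hΦ.continuous_iteratedFDeriv (by exact_mod_cast le_top))

theorem continuous_pairing_slice {n : ℕ} (T : CompactDistribution n) {V : Type*}
    [NormedAddCommGroup V] [NormedSpace ℝ V] {Φ : V × Euc n → ℂ} (hΦ : ContDiff ℝ ∞ Φ) :
    Continuous fun y => T.1 (slice hΦ y) :=
  continuous_pairing T (continuous_iteratedFDeriv_slice hΦ)

/-- A compactly supported distribution commutes with the integral over a parameter that ranges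
over a compact set. -/
theorem pairing_integral_slice {n : ℕ} (T : CompactDistribution n) {V : Type*}
    [NormedAddCommGroup V] [NormedSpace ℝ V] [SecondCountableTopology V] [MeasurableSpace V]
    [OpensMeasurableSpace V] (ν : Measure V) [IsFiniteMeasureOnCompacts ν] {Φ : V × Euc n → ℂ}
    (hΦ : ContDiff ℝ ∞ Φ) {A : Set V} (hA : IsCompact A) (hA0 : ∀ y ∉ A, ∀ x, Φ (y, x) = 0)
    (φ : Smooth n) (hφ : ∀ x, φ.1 x = ∫ y, Φ (y, x) ∂ν) :
    T.1 φ = ∫ y, T.1 (slice hΦ y) ∂ν := by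
  refine pairing_integral T ν (continuous_iteratedFDeriv_slice hΦ) (fun R j => ?_) φ hφ
  obtain ⟨M, hM⟩ := (hA.prod (isCompact_closedBall (0 : Euc n) R)).exists_bound_of_continuousOn
    (continuous_iteratedFDeriv_slice hΦ j).continuousOn
  refine ⟨A.indicator fun _ => M, (integrable_indicator_iff hA.measurableSet).2
    (integrableOn_const hA.measure_lt_top.ne), fun y x hx => ?_⟩
  by_cases hy : y ∈ A
  · rw [Set.indicator_of_mem hy]
    exact hM (y, x) ⟨hy, by simpa using hx⟩
  · rw [Set.indicator_of_notMem hy]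
    have : (slice hΦ y).1 = 0 := funext fun x => hA0 y hy x
    simp [this]

/-! ### Plane waves and the Fourier transform -/

/-- The plane wave `x ↦ exp (i x ⬝ y)`. -/
def planeWave {n : ℕ} (y : Euc n) : Smooth n :=
  ⟨fun x => Complex.exp (Complex.I * (inner ℝ x y : ℝ)), by
    have h : ContDiff ℝ ∞ fun x : Euc n => ((inner ℝ x y : ℝ) : ℂ) :=
      Complex.ofRealCLM.contDiff.comp (contDiff_id.inner ℝ contDiff_const)
    exact (contDiff_const.mul h).cexp⟩

theorem contDiff_smul_planeWave {n : ℕ} {g : Euc n → ℂ} (hg : ContDiff ℝ ∞ g) :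
    ContDiff ℝ ∞ fun q : Euc n × Euc n =>
      g q.1 * Complex.exp (Complex.I * ((2 * Real.pi * inner ℝ q.1 q.2 : ℝ) : ℂ)) := by
  have h : ContDiff ℝ ∞ fun q : Euc n × Euc n => ((2 * Real.pi * inner ℝ q.1 q.2 : ℝ) : ℂ) :=
    Complex.ofRealCLM.contDiff.comp (contDiff_const.mul (contDiff_fst.inner ℝ contDiff_snd))
  exact (hg.comp contDiff_fst).mul (contDiff_const.mul h).cexp

/-- The growth in `y` is only polynomial, so a Schwartz weight in the frequency makes Fourier
inversion a dominated integral of smooth functions. -/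
theorem norm_iteratedFDeriv_planeWave_le {n : ℕ} (y : Euc n) (j : ℕ) (x : Euc n) :
    ‖iteratedFDeriv ℝ j (planeWave y).1 x‖ ≤ ‖y‖ ^ j := by
  have hg : ContDiff ℝ ∞ fun t : ℝ => Complex.exp (Complex.I * (t : ℂ)) :=
    (contDiff_const.mul Complex.ofRealCLM.contDiff).cexp
  have h1 : (planeWave y).1 =
      (fun t : ℝ => Complex.exp (Complex.I * (t : ℂ))) ∘ innerSL ℝ y := by
    funext x
    simp [planeWave, real_inner_comm]
  have hit : ∀ j, iteratedDeriv j (fun t : ℝ => Complex.exp (Complex.I * (t : ℂ))) =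
      fun t : ℝ => Complex.I ^ j * Complex.exp (Complex.I * (t : ℂ)) := by
    intro j
    induction j with
    | zero => simp
    | succ j ih =>
      rw [iteratedDeriv_succ, ih]
      funext t
      have h2 : HasDerivAt (fun t : ℝ => Complex.I * (t : ℂ)) Complex.I t := by
        simpa using (Complex.ofRealCLM.hasDerivAt (x := t)).const_mul Complex.I
      rw [(h2.cexp.const_mul (Complex.I ^ j)).deriv]
      ring
  rw [h1, ContinuousLinearMap.iteratedFDeriv_comp_right _ hg _ (by exact_mod_cast le_top)]
  refine (ContinuousMultilinearMap.norm_compContinuousLinearMap_le _ _).trans ?_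
  rw [norm_iteratedFDeriv_eq_norm_iteratedDeriv, hit]
  simp [Complex.norm_exp]

/-- A compactly supported distribution is determined by its Fourier transform. -/
theorem eq_zero_of_planeWave {n : ℕ} (T : CompactDistribution n)
    (h : ∀ y, T.1 (planeWave y) = 0) : T = 0 := by
  obtain ⟨R, hR⟩ := exists_pairing_eq_of_eqOn_ball T
  -- The cut-off is 1 on the ball that `T` sees; the `max` with 1 keeps the inner radius positive.
  let χ : ContDiffBump (0 : Euc n) := ⟨max R 1, max R 1 + 1, by positivity, by linarith⟩
  ext φ
  let gfun : Euc n → ℂ := fun x => (χ x : ℂ) * φ.1 x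
  have hχ : ContDiff ℝ ∞ fun x => (χ x : ℂ) := Complex.ofRealCLM.contDiff.comp χ.contDiff
  have hg : ContDiff ℝ ∞ gfun := hχ.mul φ.2
  have hgc : HasCompactSupport gfun :=
    HasCompactSupport.mul_right (χ.hasCompactSupport.comp_left (g := fun r : ℝ => (r : ℂ)) rfl)
  let g : SchwartzMap (Euc n) ℂ := hgc.toSchwartzMap hg
  let ĝ : SchwartzMap (Euc n) ℂ := 𝓕 g
  have hinv : ∀ x, gfun x =
      ∫ v, ĝ v * Complex.exp (Complex.I * ((2 * Real.pi * inner ℝ v x : ℝ) : ℂ)) := by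
    intro x
    have h1 : (𝓕⁻ ĝ) x = g x := by rw [FourierPair.fourierInv_fourier_eq g]
    rw [SchwartzMap.fourierInv_coe, Real.fourierInv_eq'] at h1
    refine (h1.symm.trans ?_ : g x = _)
    refine integral_congr_ae (Filter.Eventually.of_forall fun v => ?_)
    simp only [smul_eq_mul]
    rw [mul_comm, mul_comm Complex.I]
  have hsl : ∀ v, slice (contDiff_smul_planeWave (ĝ.smooth ⊤)) v =
      ĝ v • planeWave ((2 * Real.pi) • v) := by
    intro v
    refine Subtype.ext (funext fun x => ?_)
    simp only [slice, planeWave, Submodule.coe_smul, Pi.smul_apply, smul_eq_mul, inner_smul_right,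
      real_inner_comm]
  have key : T.1 ⟨gfun, hg⟩ =
      ∫ v, T.1 (slice (contDiff_smul_planeWave (ĝ.smooth ⊤)) v) := by
    refine pairing_integral T volume (continuous_iteratedFDeriv_slice _) (fun R j => ?_) _ hinv
    refine ⟨fun v => (2 * Real.pi) ^ j * (‖v‖ ^ j * ‖ĝ v‖),
      (ĝ.integrable_pow_mul volume j).const_mul _, fun v x _ => ?_⟩
    rw [hsl, Submodule.coe_smul, iteratedFDeriv_const_smul_apply (contDiffAt_of_smooth _ j x),
      norm_smul]
    calc ‖ĝ v‖ * _ ≤ ‖ĝ v‖ * ‖(2 * Real.pi) • v‖ ^ j := by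
          gcongr; exact norm_iteratedFDeriv_planeWave_le _ j x
      _ = _ := by
          rw [norm_smul, Real.norm_of_nonneg (by positivity)]; ring
  have hφ : T.1 φ = T.1 ⟨gfun, hg⟩ := by
    refine hR _ _ fun x hx => ?_
    have : χ x = 1 := χ.one_of_mem_closedBall (by
      rw [mem_closedBall_zero_iff]; exact hx.le.trans (le_max_left _ _))
    simp [gfun, this]
  rw [hφ, key, integral_congr_ae (g := fun _ => (0 : ℂ)) (Filter.Eventually.of_forall fun v => by
    simp only [hsl, map_smul, h, smul_zero])]
  simp

/-! ### Symmetric forms, polynomials and Taylor remainders -/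

/-- Two words with the same letters, counted with multiplicity, differ by a permutation. -/
theorem exists_perm_of_sum_single_eq {n p : ℕ} {I J : Fin p → Fin n}
    (h : ∑ j, Finsupp.single (I j) 1 = (∑ j, Finsupp.single (J j) 1 : Fin n →₀ ℕ)) :
    ∃ π : Equiv.Perm (Fin p), I = J ∘ π := by
  have hcard : ∀ i, Fintype.card {a // I a = i} = Fintype.card {b // J b = i} := by
    intro i
    have := DFunLike.congr_fun h i
    simpa [Finsupp.finsetSum_apply, Finsupp.single_apply, Fintype.card_subtype] using this
  refine ⟨Equiv.ofFiberEquiv fun i => Fintype.equivOfCardEq (hcard i), funext fun a => ?_⟩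
  exact (Equiv.ofFiberEquiv_map _ a).symm

/-- A symmetric tensor is determined by its values on the diagonal. -/
theorem eq_zero_of_symmetric_of_form_eq_zero {n p : ℕ} {c : (Fin p → Fin n) → ℂ}
    (hc : ∀ (π : Equiv.Perm (Fin p)) (I : Fin p → Fin n), c (I ∘ π) = c I)
    (h : ∀ ξ : Euc n, ∑ I, (∏ j, (ξ (I j) : ℂ)) * c I = 0) (I₀ : Fin p → Fin n) :
    c I₀ = 0 := by
  let P : MvPolynomial (Fin n) ℂ :=
    ∑ I, MvPolynomial.monomial (∑ j, Finsupp.single (I j) 1) (c I)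
  have hP : P = 0 := by
    refine MvPolynomial.funext_set (fun _ => Set.range ((↑) : ℝ → ℂ))
      (fun _ => Set.infinite_range_of_injective Complex.ofReal_injective) fun x hx => ?_
    choose ξ hξ using fun i => hx i (Set.mem_univ i)
    have hξ' := h (WithLp.toLp 2 ξ)
    simp only [hξ] at hξ'
    simp only [P, map_sum, MvPolynomial.eval_monomial, map_zero]
    rw [← hξ']
    refine Finset.sum_congr rfl fun I _ => ?_
    rw [mul_comm, ← Finsupp.prod_finsetSum_index (by simp) (by intros; simp [pow_add])]
    simp
  have hcoef := congrArg (MvPolynomial.coeff (∑ j, Finsupp.single (I₀ j) 1)) hP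
  simp only [P, MvPolynomial.coeff_sum, MvPolynomial.coeff_monomial, MvPolynomial.coeff_zero]
    at hcoef
  -- Only rearrangements of `I₀` contribute to its monomial, and each contributes `c I₀`; the
  -- coefficient is therefore a positive integer times `c I₀`.
  have hsum : ∀ I : Fin p → Fin n,
      (if (∑ j, Finsupp.single (I j) 1 : Fin n →₀ ℕ) = ∑ j, Finsupp.single (I₀ j) 1
        then c I else 0) =
      (if (∑ j, Finsupp.single (I j) 1 : Fin n →₀ ℕ) = ∑ j, Finsupp.single (I₀ j) 1
        then 1 else 0) * c I₀ := by
    intro I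
    split_ifs with hI
    · obtain ⟨π, rfl⟩ := exists_perm_of_sum_single_eq hI
      rw [hc, one_mul]
    · rw [zero_mul]
  rw [Finset.sum_congr rfl fun I _ => hsum I, ← Finset.sum_mul, Finset.sum_boole] at hcoef
  refine (mul_eq_zero.1 hcoef).resolve_left (Nat.cast_ne_zero.2 (Finset.card_ne_zero_of_mem
    (a := I₀) ?_))
  simp

/-- A polynomial of degree at most `m` that vanishes to order `m + 1` at the origin is zero. -/
theorem polynomial_eq_zero_of_eval_eq_pow_mul {m : ℕ} {Q : Polynomial ℂ} (hQ : Q.natDegree ≤ m)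
    {g : ℝ → ℂ} (hg : ContinuousAt g 0)
    (h : ∀ u : ℝ, Q.eval (u : ℂ) = (u : ℂ) ^ (m + 1) * g u) : Q = 0 := by
  by_contra hne
  obtain ⟨P, hP, hP0⟩ := Polynomial.exists_eq_pow_rootMultiplicity_mul_and_not_dvd Q hne 0
  set r := Q.rootMultiplicity 0
  rw [Polynomial.C_0, sub_zero] at hP hP0
  rw [Polynomial.X_dvd_iff, Polynomial.coeff_zero_eq_eval_zero] at hP0
  have hr : r ≤ m := by
    simpa using (Polynomial.natDegree_le_of_dvd (Dvd.intro P hP.symm) hne).trans hQ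
  apply hP0
  -- After division by `u ^ r` a positive power of `u` is left on the right, so `P` tends to 0 at
  -- the origin, against `hP0`.
  have h1 : ∀ u : ℝ, u ≠ 0 → P.eval (u : ℂ) = (u : ℂ) ^ (m + 1 - r) * g u := by
    intro u hu
    have h2 := h u
    rw [hP, Polynomial.eval_mul, Polynomial.eval_pow, Polynomial.eval_X,
      show m + 1 = r + (m + 1 - r) by omega, pow_add, mul_assoc] at h2
    simpa using mul_left_cancel₀ (pow_ne_zero r (Complex.ofReal_ne_zero.2 hu)) h2
  have hl : Filter.Tendsto (fun u : ℝ => P.eval (u : ℂ)) (nhdsWithin 0 {0}ᶜ)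
      (nhds (P.eval 0)) := by
    have : Continuous fun u : ℝ => P.eval (u : ℂ) := by fun_prop
    simpa using (this.tendsto 0).mono_left nhdsWithin_le_nhds
  have hr' : Filter.Tendsto (fun u : ℝ => (u : ℂ) ^ (m + 1 - r) * g u) (nhdsWithin 0 {0}ᶜ)
      (nhds 0) := by
    have h3 : ContinuousAt (fun u : ℝ => (u : ℂ) ^ (m + 1 - r) * g u) 0 := by fun_prop
    have h4 := h3.tendsto.mono_left (nhdsWithin_le_nhds (s := {0}ᶜ))
    simpa [show m + 1 - r ≠ 0 by omega] using h4
  refine tendsto_nhds_unique hl (hr'.congr' ?_)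
  filter_upwards [self_mem_nhdsWithin] with u hu
  exact (h1 u hu).symm

/-- Taylor expansion of an entire function with an entire remainder. -/
theorem exists_entire_remainder {f : ℂ → ℂ} (hf : Differentiable ℂ f) (m : ℕ) :
    ∃ (a : ℕ → ℂ) (g : ℂ → ℂ), Differentiable ℂ g ∧
      ∀ z, f z = ∑ k ∈ Finset.range m, a k * z ^ k + z ^ m * g z := by
  induction m with
  | zero => exact ⟨0, f, hf, by simp⟩
  | succ m ih =>
    obtain ⟨a, g, hg, h⟩ := ih
    refine ⟨Function.update a m (g 0), dslope g 0, ?_, fun z => ?_⟩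
    · rw [← differentiableOn_univ] at hg ⊢
      exact (Complex.differentiableOn_dslope Filter.univ_mem).2 hg
    · have h0 : g z = g 0 + z * dslope g 0 z := by
        have := sub_smul_dslope g 0 z
        simp only [sub_zero, smul_eq_mul] at this
        rw [this]; ring
      rw [h z, Finset.sum_range_succ, Function.update_self, h0]
      have : ∑ k ∈ Finset.range m, Function.update a m (g 0) k * z ^ k =
          ∑ k ∈ Finset.range m, a k * z ^ k := by
        refine Finset.sum_congr rfl fun k hk => ?_
        rw [Function.update_of_ne (Finset.mem_range.1 hk).ne]
      rw [this]
      ring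

/-! ### Bump functions with prescribed moments -/

/-- There are bump functions with prescribed moments of order at most `m`. -/
theorem exists_bump_moments (m : ℕ) (c : Fin (m + 1) → ℝ) :
    ∃ ρ : ℝ → ℝ, ContDiff ℝ ∞ ρ ∧ HasCompactSupport ρ ∧
      ∀ j : Fin (m + 1), ∫ τ, τ ^ (j : ℕ) * ρ τ = c j := by
  let b : ContDiffBump (0 : ℝ) := ⟨1, 2, one_pos, one_lt_two⟩
  have hcont : ∀ v : Fin (m + 1) → ℝ, ContDiff ℝ ∞ fun τ => b τ * ∑ i, v i * τ ^ (i : ℕ) :=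
    fun v => b.contDiff.mul (ContDiff.sum fun i _ => contDiff_const.mul (contDiff_id.pow _))
  have hsupp : ∀ v : Fin (m + 1) → ℝ, HasCompactSupport fun τ => b τ * ∑ i, v i * τ ^ (i : ℕ) :=
    fun v => b.hasCompactSupport.mul_right
  have hint : ∀ (v : Fin (m + 1) → ℝ) (j : ℕ),
      Integrable fun τ => τ ^ j * (b τ * ∑ i, v i * τ ^ (i : ℕ)) := fun v j =>
    ((continuous_pow j).mul (hcont v).continuous).integrable_of_hasCompactSupport
      (hsupp v).mul_left
  let L : (Fin (m + 1) → ℝ) →ₗ[ℝ] (Fin (m + 1) → ℝ) :=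
    { toFun := fun v j => ∫ τ, τ ^ (j : ℕ) * (b τ * ∑ i, v i * τ ^ (i : ℕ))
      map_add' := fun v w => by
        funext j
        rw [Pi.add_apply, ← integral_add (hint v j) (hint w j)]
        refine integral_congr_ae (Filter.Eventually.of_forall fun τ => ?_)
        simp only [Pi.add_apply, add_mul, Finset.sum_add_distrib]
        ring
      map_smul' := fun r v => by
        funext j
        rw [Pi.smul_apply, smul_eq_mul, RingHom.id_apply, ← integral_const_mul]
        refine integral_congr_ae (Filter.Eventually.of_forall fun τ => ?_)
        simp only [Pi.smul_apply, smul_eq_mul, mul_assoc, ← Finset.mul_sum]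
        ring }
  -- `L` is the Gram matrix of the monomials for the weight `b`: pairing `L v` with `v` gives the
  -- integral of `b` times the square of the polynomial with coefficients `v`. If it is 0, the
  -- polynomial vanishes where `b = 1`.
  have hinj : Function.Injective L := by
    rw [← LinearMap.ker_eq_bot, LinearMap.ker_eq_bot']
    intro v hv
    have hq : ∫ τ, b τ * (∑ i, v i * τ ^ (i : ℕ)) ^ 2 = 0 := by
      have h1 : ∫ τ, b τ * (∑ i, v i * τ ^ (i : ℕ)) ^ 2 = ∑ j, v j * L v j := by
        simp only [L, LinearMap.coe_mk, AddHom.coe_mk]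
        simp only [← integral_const_mul]
        rw [← integral_finsetSum _ fun (j : Fin (m + 1)) _ => (hint v j).const_mul (v j)]
        refine integral_congr_ae (Filter.Eventually.of_forall fun τ => ?_)
        simp only [← mul_assoc, ← Finset.sum_mul]
        ring
      rw [h1, hv]
      simp
    have hcq : Continuous fun τ => b τ * (∑ i, v i * τ ^ (i : ℕ)) ^ 2 :=
      b.continuous.mul (by fun_prop)
    have h0 : (fun τ => b τ * (∑ i, v i * τ ^ (i : ℕ)) ^ 2) = 0 := by
      refine (hcq.ae_eq_iff_eq volume continuous_zero).1 ((integral_eq_zero_iff_of_nonneg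
        (fun τ => mul_nonneg b.nonneg (sq_nonneg _)) ?_).1 hq)
      exact hcq.integrable_of_hasCompactSupport b.hasCompactSupport.mul_right
    let P : Polynomial ℝ := ∑ i : Fin (m + 1), Polynomial.monomial (i : ℕ) (v i)
    have hP : P = 0 := by
      refine Polynomial.eq_zero_of_infinite_isRoot P
        ((Set.Ioo_infinite (zero_lt_one (α := ℝ))).mono fun τ hτ => ?_)
      have h2 := congrFun h0 τ
      have hb : b τ = 1 := b.one_of_mem_closedBall (by
        simp only [mem_closedBall_zero_iff, Real.norm_eq_abs, abs_of_pos hτ.1, b]; exact hτ.2.le)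
      simp only [hb, one_mul, Pi.zero_apply] at h2
      simpa [P, Polynomial.IsRoot, Polynomial.eval_finsetSum] using h2
    funext j
    have := congrArg (fun P => Polynomial.coeff P j) hP
    simpa [P, Polynomial.finsetSum_coeff, Polynomial.coeff_monomial, Fin.val_inj] using this
  obtain ⟨v, hv⟩ := LinearMap.injective_iff_surjective.1 hinj c
  exact ⟨_, hcont v, hsupp v, fun j => congrFun hv j⟩

/-- For `k ≤ m` there is a bump function whose convolution with `t ^ m` is `s ^ k`. -/
theorem exists_bump_convolution_pow {k m : ℕ} (hk : k ≤ m) :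
    ∃ ρ : ℝ → ℝ, ContDiff ℝ ∞ ρ ∧ HasCompactSupport ρ ∧
      ∀ s : ℝ, ∫ t : ℝ, (t : ℂ) ^ m * (ρ (s - t) : ℂ) = (s : ℂ) ^ k := by
  -- In the expansion of `(s - τ) ^ m`, the power `s ^ k` comes with `(-1) ^ (m - k) * m.choose k`
  -- and the moment of order `m - k`; all other moments up to order `m` are set to 0.
  obtain ⟨ρ, hρ, hρc, hρm⟩ := exists_bump_moments m
    fun j => if (j : ℕ) = m - k then (-1) ^ (m - k) / (m.choose k : ℝ) else 0
  refine ⟨ρ, hρ, hρc, fun s => ?_⟩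
  have hint : ∀ j : ℕ, Integrable fun τ : ℝ => τ ^ j * ρ τ := fun j =>
    ((continuous_pow j).mul hρ.continuous).integrable_of_hasCompactSupport hρc.mul_left
  have h1 : ∫ t : ℝ, t ^ m * ρ (s - t) = s ^ k := by
    rw [← integral_sub_left_eq_self _ volume s]
    simp only [sub_sub_cancel]
    have h2 : ∀ τ : ℝ, (s - τ) ^ m * ρ τ = ∑ j ∈ Finset.range (m + 1),
        (s ^ j * (-1) ^ (m - j) * (m.choose j : ℝ)) * (τ ^ (m - j) * ρ τ) := by
      intro τ
      rw [sub_eq_add_neg, add_pow, Finset.sum_mul]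
      refine Finset.sum_congr rfl fun j _ => ?_
      rw [neg_pow τ]
      ring
    simp only [h2]
    rw [integral_finsetSum _ fun j _ => (hint _).const_mul _]
    rw [Finset.sum_eq_single_of_mem k (by simp; omega)]
    · rw [integral_const_mul, hρm ⟨m - k, by omega⟩]
      have : (m.choose k : ℝ) ≠ 0 := Nat.cast_ne_zero.2 (Nat.choose_pos hk).ne'
      have h3 : ((-1 : ℝ) ^ (m - k)) * (-1) ^ (m - k) = 1 := by
        rw [← mul_pow]; simp
      simp only [if_true]
      field_simp
      linear_combination (s ^ k) * h3
    · intro j hj hjk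
      rw [integral_const_mul, hρm ⟨m - j, by omega⟩]
      have : m - j ≠ m - k := by have := Finset.mem_range.1 hj; omega
      simp [this]
  have h4 := congrArg (fun r : ℝ => (r : ℂ)) h1
  rw [← integral_complex_ofReal] at h4
  push_cast at h4
  exact h4

/-! ### Expansion of plane waves and vanishing of a single tensor field -/

theorem contDiff_inner_ofReal {n : ℕ} {V : Type*} [NormedAddCommGroup V] [NormedSpace ℝ V]
    {f g : V → Euc n} (hf : ContDiff ℝ ∞ f) (hg : ContDiff ℝ ∞ g) :
    ContDiff ℝ ∞ fun v => ((inner ℝ (f v) (g v) : ℝ) : ℂ) :=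
  Complex.ofRealCLM.contDiff.comp (hf.inner ℝ hg)

/-- The function `x ↦ (x ⬝ ξ) ^ k exp (i x ⬝ y)`. -/
def rayWave {n : ℕ} (k : ℕ) (ξ y : Euc n) : Smooth n :=
  ⟨fun x => ((inner ℝ x ξ : ℝ) : ℂ) ^ k * Complex.exp (Complex.I * (inner ℝ x y : ℝ)),
    ((contDiff_inner_ofReal contDiff_id contDiff_const).pow k).mul
      (contDiff_const.mul (contDiff_inner_ofReal contDiff_id contDiff_const)).cexp⟩

theorem rayWave_smul {n : ℕ} (k : ℕ) (r : ℝ) (ξ y : Euc n) :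
    rayWave k (r • ξ) y = ((r : ℂ) ^ k) • rayWave k ξ y := by
  refine Subtype.ext (funext fun x => ?_)
  simp only [rayWave, inner_smul_right, Submodule.coe_smul, Pi.smul_apply, smul_eq_mul,
    Complex.ofReal_mul, mul_pow, mul_assoc]

theorem continuous_pairing_planeWave {n : ℕ} (T : CompactDistribution n) :
    Continuous fun y => T.1 (planeWave y) :=
  continuous_pairing_slice T (Φ := fun q : Euc n × Euc n =>
    Complex.exp (Complex.I * (inner ℝ q.2 q.1 : ℝ)))
    (contDiff_const.mul (contDiff_inner_ofReal contDiff_snd contDiff_fst)).cexp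

/-- The span of `y` has dimension at most 1. The assumption `2 ≤ n` is essential here: it lets a
direction parallel to `y` be approximated by non-parallel ones. -/
theorem exists_orthogonal_ne_zero {n : ℕ} (hn : 2 ≤ n) (y : Euc n) :
    ∃ η : Euc n, η ≠ 0 ∧ inner ℝ η y = 0 := by
  by_contra! h
  have h1 : (Submodule.span ℝ {y})ᗮ = ⊥ := by
    rw [Submodule.eq_bot_iff]
    intro η hη
    by_contra hne
    exact h η hne (by rw [real_inner_comm]; exact Submodule.mem_orthogonal_singleton_iff_inner_right.1 hη)
  have h2 : Submodule.span ℝ {y} = ⊤ := Submodule.orthogonal_eq_bot_iff.1 h1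
  have h3 := finrank_span_le_card (R := ℝ) ({y} : Set (Euc n))
  rw [h2, finrank_top] at h3
  simp at h3
  omega

/-- Expansion of a plane wave around the direction of its frequency vector: with
`ξ = η + u y` and `y = s ξ + ζ`, where `η ⊥ y` and `ζ ⊥ ξ`, one has `s = O(u)`. -/
theorem exists_planeWave_expansion {n : ℕ} (m : ℕ) {y η : Euc n} (hη : η ≠ 0)
    (hηy : inner ℝ η y = 0) :
    ∃ (Φ : ℝ × Euc n → ℂ) (hΦ : ContDiff ℝ ∞ Φ) (a : ℕ → ℝ → ℂ) (ζ : ℝ → Euc n),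
      ∀ u : ℝ, inner ℝ (η + u • y) (ζ u) = 0 ∧
        planeWave y = ∑ k ∈ Finset.range (m + 1), a k u • rayWave k (η + u • y) (ζ u) +
          (u : ℂ) ^ (m + 1) • slice hΦ u := by
  obtain ⟨a, g, hg, hexp⟩ := exists_entire_remainder Complex.differentiable_exp (m + 1)
  have hg' : ContDiff ℝ ∞ g := hg.contDiff.restrict_scalars ℝ
  -- By orthogonality `D u` is the squared norm of ξ = `η + u • y`, so the coefficient of ξ in `y`
  -- is `u * (‖y‖ ^ 2 / D u)`, with an explicit factor `u`.
  let D : ℝ → ℝ := fun u => ‖η‖ ^ 2 + u ^ 2 * ‖y‖ ^ 2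
  have hD : ∀ u, D u ≠ 0 := fun u => by
    have : 0 < ‖η‖ := norm_pos_iff.2 hη
    positivity
  have hDs : ContDiff ℝ ∞ D := by fun_prop
  let ζ : ℝ → Euc n := fun u => (‖η‖ ^ 2 / D u) • y - (u * (‖y‖ ^ 2 / D u)) • η
  have hy : ∀ u, y = (u * (‖y‖ ^ 2 / D u)) • (η + u • y) + ζ u := by
    intro u
    simp only [ζ, smul_add, smul_smul]
    have : (u * (‖y‖ ^ 2 / D u) * u) + ‖η‖ ^ 2 / D u = 1 := by
      have := hD u
      field_simp
      simp only [D]; ring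
    calc y = (1 : ℝ) • y := (one_smul _ _).symm
      _ = _ := by rw [← this, add_smul]; abel
  have hζ : ∀ u, inner ℝ (η + u • y) (ζ u) = 0 := by
    intro u
    have hyη : inner ℝ y η = 0 := by rw [real_inner_comm]; exact hηy
    simp only [ζ, inner_sub_right, inner_add_left, inner_smul_left, inner_smul_right, hηy, hyη,
      real_inner_self_eq_norm_sq, conj_trivial]
    ring
  have hc : ContDiff ℝ ∞ fun u => ‖y‖ ^ 2 / D u := contDiff_const.div hDs hD
  have hζs : ContDiff ℝ ∞ ζ :=
    ((contDiff_const.div hDs hD).smul contDiff_const).sub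
      ((contDiff_id.mul hc).smul contDiff_const)
  have hcC : ContDiff ℝ ∞ fun q : ℝ × Euc n => ((‖y‖ ^ 2 / D q.1 : ℝ) : ℂ) :=
    Complex.ofRealCLM.contDiff.comp (hc.comp contDiff_fst)
  have huC : ContDiff ℝ ∞ fun q : ℝ × Euc n => (q.1 : ℂ) :=
    Complex.ofRealCLM.contDiff.comp contDiff_fst
  have hinξ : ContDiff ℝ ∞ fun q : ℝ × Euc n => ((inner ℝ q.2 (η + q.1 • y) : ℝ) : ℂ) :=
    contDiff_inner_ofReal contDiff_snd (contDiff_const.add (contDiff_fst.smul contDiff_const))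
  have hinζ : ContDiff ℝ ∞ fun q : ℝ × Euc n => ((inner ℝ q.2 (ζ q.1) : ℝ) : ℂ) :=
    contDiff_inner_ofReal contDiff_snd (hζs.comp contDiff_fst)
  -- The exponent along ξ is `u * w` with `w` smooth up to `u = 0`; hence the Taylor remainder
  -- carries the full factor `u ^ (m + 1)`.
  let w : ℝ × Euc n → ℂ := fun q =>
    Complex.I * ((‖y‖ ^ 2 / D q.1 : ℝ) : ℂ) * ((inner ℝ q.2 (η + q.1 • y) : ℝ) : ℂ)
  have hw : ContDiff ℝ ∞ w := (contDiff_const.mul hcC).mul hinξ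
  refine ⟨fun q => w q ^ (m + 1) * g (q.1 * w q) *
      Complex.exp (Complex.I * (inner ℝ q.2 (ζ q.1) : ℝ)),
    ((hw.pow _).mul (hg'.comp (huC.mul hw))).mul (contDiff_const.mul hinζ).cexp,
    fun k u => a k * (Complex.I * ((u * (‖y‖ ^ 2 / D u) : ℝ) : ℂ)) ^ k, ζ, fun u => ⟨hζ u, ?_⟩⟩
  refine Subtype.ext (funext fun x => ?_)
  have hx : Complex.exp (Complex.I * (inner ℝ x y : ℝ)) =
      Complex.exp (u * w (u, x)) * Complex.exp (Complex.I * (inner ℝ x (ζ u) : ℝ)) := by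
    rw [← Complex.exp_add]
    congr 1
    conv_lhs => rw [hy u]
    simp only [w, inner_add_right, inner_smul_right]
    push_cast
    ring
  simp only [planeWave, rayWave, slice, Submodule.coe_add, Submodule.coe_sum, Submodule.coe_smul,
    Pi.add_apply, Finset.sum_apply, Pi.smul_apply, smul_eq_mul]
  rw [hx, hexp, add_mul, Finset.sum_mul, mul_pow]
  congr 1
  · refine Finset.sum_congr rfl fun k _ => ?_
    simp only [w]
    push_cast
    ring
  · ring

/-- A symmetric tensor field of rank `p ≤ m` is zero if, for every direction `ξ`, the restriction
of its Fourier transform to the direction `ξ` vanishes to order `m + 1` along the hyperplane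
orthogonal to `ξ`. -/
theorem symTensor_eq_zero_of_rayWave {n m p : ℕ} (hn : 2 ≤ n) (hp : p ≤ m) (f : SymTensor n p)
    (H : ∀ ξ y : Euc n, ‖ξ‖ = 1 → inner ℝ ξ y = 0 → ∀ k ≤ m,
      ∑ I, (∏ j, (ξ (I j) : ℂ)) * (f.1 I).1 (rayWave k ξ y) = 0) : f = 0 := by
  -- The sum is homogeneous of degree `p + k` in ξ, so the normalisation of ξ can be dropped.
  have H' : ∀ ξ y : Euc n, inner ℝ ξ y = 0 → ξ ≠ 0 → ∀ k ≤ m,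
      ∑ I, (∏ j, (ξ (I j) : ℂ)) * (f.1 I).1 (rayWave k ξ y) = 0 := by
    intro ξ y hξy hξ k hk
    have hpos : ‖ξ‖ ≠ 0 := norm_ne_zero_iff.2 hξ
    have h1 := H (‖ξ‖⁻¹ • ξ) y (by rw [norm_smul, norm_inv, norm_norm, inv_mul_cancel₀ hpos])
      (by rw [inner_smul_left, hξy, mul_zero]) k hk
    have h2 : ∑ I, (∏ j, (((‖ξ‖⁻¹ • ξ) (I j) : ℝ) : ℂ)) * (f.1 I).1 (rayWave k (‖ξ‖⁻¹ • ξ) y) =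
        ((‖ξ‖⁻¹ : ℝ) : ℂ) ^ (p + k) *
          ∑ I, (∏ j, (ξ (I j) : ℂ)) * (f.1 I).1 (rayWave k ξ y) := by
      rw [Finset.mul_sum]
      refine Finset.sum_congr rfl fun I _ => ?_
      rw [rayWave_smul, map_smul, smul_eq_mul]
      simp only [PiLp.smul_apply, smul_eq_mul, Complex.ofReal_mul, Finset.prod_mul_distrib,
        Finset.prod_const, Finset.card_univ, Fintype.card_fin, pow_add]
      ring
    rw [h2] at h1
    refine (mul_eq_zero.1 h1).resolve_left (pow_ne_zero _ ?_)
    exact_mod_cast inv_ne_zero hpos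
  have hline : ∀ y η : Euc n, η ≠ 0 → inner ℝ η y = 0 → ∀ u : ℝ,
      ∑ I, (∏ j, (((η + u • y) (I j) : ℝ) : ℂ)) * (f.1 I).1 (planeWave y) = 0 := by
    intro y η hη hηy u
    let Q : Polynomial ℂ := ∑ I : Fin p → Fin n,
      (∏ j, (Polynomial.C (η (I j) : ℂ) + Polynomial.C (y (I j) : ℂ) * Polynomial.X)) *
        Polynomial.C ((f.1 I).1 (planeWave y))
    have hQe : ∀ u : ℝ, Q.eval (u : ℂ) =
        ∑ I, (∏ j, (((η + u • y) (I j) : ℝ) : ℂ)) * (f.1 I).1 (planeWave y) := by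
      intro u
      simp only [Q, Polynomial.eval_finsetSum, Polynomial.eval_mul, Polynomial.eval_prod,
        Polynomial.eval_add, Polynomial.eval_C, Polynomial.eval_X, PiLp.add_apply,
        PiLp.smul_apply, smul_eq_mul, Complex.ofReal_add, Complex.ofReal_mul, mul_comm (u : ℂ)]
    have hQd : Q.natDegree ≤ m := by
      refine (Polynomial.natDegree_sum_le_of_forall_le _ _ fun I _ => ?_).trans hp
      refine Polynomial.natDegree_mul_C_le _ _ |>.trans
        ((Polynomial.natDegree_prod_le _ _).trans ?_)
      refine (Finset.sum_le_card_nsmul _ _ 1 fun j _ => ?_).trans (by simp)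
      exact (Polynomial.natDegree_add_le _ _).trans (by
        simp only [Polynomial.natDegree_C, max_le_iff, zero_le, true_and]
        exact (Polynomial.natDegree_C_mul_le _ _).trans Polynomial.natDegree_X_le)
    obtain ⟨Φ, hΦ, a, ζ, hexp⟩ := exists_planeWave_expansion m hη hηy
    -- The terms of order at most `m` in the expansion vanish by `H'`, since `ζ u` is orthogonal to
    -- ξ; what is left is `u ^ (m + 1)` times a continuous function, while `Q` has degree at most
    -- `m`.
    have hQ : Q = 0 := by
      refine polynomial_eq_zero_of_eval_eq_pow_mul hQd
        (g := fun u => ∑ I, (∏ j, (((η + u • y) (I j) : ℝ) : ℂ)) * (f.1 I).1 (slice hΦ u))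
        ?_ fun u => ?_
      · refine (continuous_finsetSum _ fun I _ => Continuous.mul ?_
          (continuous_pairing_slice _ hΦ)).continuousAt
        simp only [PiLp.add_apply, PiLp.smul_apply]
        fun_prop
      · have hne : η + u • y ≠ 0 := by
          intro h0
          have : inner ℝ η (η + u • y) = 0 := by rw [h0, inner_zero_right]
          rw [inner_add_right, inner_smul_right, hηy, mul_zero, add_zero,
            inner_self_eq_zero] at this
          exact hη this
        have hterm : ∀ I, (f.1 I).1 (planeWave y) =
            ∑ k ∈ Finset.range (m + 1), a k u * (f.1 I).1 (rayWave k (η + u • y) (ζ u)) +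
              (u : ℂ) ^ (m + 1) * (f.1 I).1 (slice hΦ u) := by
          intro I
          rw [(hexp u).2]
          simp only [map_add, map_sum, map_smul, smul_eq_mul]
        rw [hQe]
        simp only [hterm, mul_add, Finset.sum_add_distrib, Finset.mul_sum]
        rw [Finset.sum_comm, Finset.sum_eq_zero, zero_add]
        · exact Finset.sum_congr rfl fun I _ => by ring
        · intro k hk
          have := H' _ _ (hexp u).1 hne k (by have := Finset.mem_range.1 hk; omega)
          calc _ = a k u * ∑ I, (∏ j, (((η + u • y) (I j) : ℝ) : ℂ)) *
                (f.1 I).1 (rayWave k (η + u • y) (ζ u)) := by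
                rw [Finset.mul_sum]
                exact Finset.sum_congr rfl fun I _ => by ring
            _ = 0 := by rw [this, mul_zero]
    rw [← hQe, hQ, Polynomial.eval_zero]
  have hform : ∀ y ξ : Euc n, y ≠ 0 →
      ∑ I, (∏ j, (ξ (I j) : ℂ)) * (f.1 I).1 (planeWave y) = 0 := by
    intro y ξ hy
    have hyy : inner ℝ y y ≠ 0 := inner_self_ne_zero.2 hy
    let u : ℝ := inner ℝ ξ y / inner ℝ y y
    have hperp : inner ℝ (ξ - u • y) y = 0 := by
      rw [inner_sub_left, inner_smul_left, conj_trivial, div_mul_cancel₀ _ hyy, sub_self]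
    by_cases hη : ξ - u • y = 0
    -- For ξ parallel to `y`, perturb by `ε • η` and let ε tend to 0.
    · obtain ⟨η, hη0, hηy⟩ := exists_orthogonal_ne_zero hn y
      have hξ : ξ = u • y := sub_eq_zero.1 hη
      let G : ℝ → ℂ := fun ε =>
        ∑ I, (∏ j, (((ε • η + u • y) (I j) : ℝ) : ℂ)) * (f.1 I).1 (planeWave y)
      have hG : Continuous G := by
        refine continuous_finsetSum _ fun I _ => Continuous.mul ?_ continuous_const
        simp only [PiLp.add_apply, PiLp.smul_apply]
        fun_prop
      have hG0 : G = fun _ => 0 := by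
        refine hG.ext_on (dense_compl_singleton (0 : ℝ)) continuous_const fun ε hε => ?_
        exact hline y (ε • η) (smul_ne_zero hε hη0) (by rw [inner_smul_left, hηy, mul_zero]) u
      have := congrFun hG0 0
      simpa only [G, zero_smul, zero_add, ← hξ] using this
    · simpa using hline y _ hη hperp u
  have hpw : ∀ (I : Fin p → Fin n) (y : Euc n), (f.1 I).1 (planeWave y) = 0 := by
    intro I
    have hne : Nontrivial (Euc n) := by
      have : Nonempty (Fin n) := ⟨⟨0, by omega⟩⟩
      infer_instance
    have h0 : (fun y => (f.1 I).1 (planeWave y)) = fun _ => 0 := by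
      -- The frequency 0 was excluded so far; it is reached by continuity.
      refine (continuous_pairing_planeWave (f.1 I)).ext_on (dense_compl_singleton (0 : Euc n))
        continuous_const fun y hy => ?_
      exact eq_zero_of_symmetric_of_form_eq_zero (c := fun I => (f.1 I).1 (planeWave y))
        (fun π I => by simp only [f.2 π I]) (fun ξ => hform y ξ hy) I
    exact congrFun h0
  refine Subtype.ext (funext fun I => ?_)
  exact eq_zero_of_planeWave _ (hpw I)

/-! ### Contraction on the unit sphere and the two parity parts -/

theorem ae_norm_eq_one (n : ℕ) : ∀ᵐ ξ ∂(sphereMeasure n), ‖ξ‖ = 1 := by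
  unfold sphereMeasure
  rw [ae_map_iff measurable_subtype_coe.aemeasurable
    (measurableSet_eq_fun measurable_norm measurable_const)]
  exact Filter.Eventually.of_forall fun ξ => by simp

theorem integrable_integral_adjointIntegrand {n p : ℕ} (ν : Measure (Euc n))
    [IsFiniteMeasureOnCompacts ν] [SFinite ν] (k : ℕ) (Ψ : TestFunction n) (I : Fin p → Fin n)
    (x : Euc n) : Integrable (fun ξ => ∫ t, adjointIntegrand k Ψ I x ξ t) ν := by
  obtain ⟨A, hA, hA0⟩ := adjointIntegrand_support k Ψ I (‖x‖ + 1)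
  have hcont : Continuous (fun q : Euc n × ℝ => adjointIntegrand k Ψ I x q.1 q.2) :=
    (adjointIntegrand_contDiff k Ψ I).continuous.comp
      (Continuous.prodMk continuous_const continuous_id)
  exact (hcont.integrable_of_hasCompactSupport (μ := ν.prod volume)
    (HasCompactSupport.intro hA fun q hq => hA0 x (by linarith) q hq)).integral_prod_left

theorem momentAdjoint_comp_perm {n p : ℕ} (ν : Measure (Euc n)) [IsFiniteMeasureOnCompacts ν]
    [SFinite ν] (k : ℕ) (Ψ : TestFunction n) (I : Fin p → Fin n) (π : Equiv.Perm (Fin p)) :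
    momentAdjoint ν k Ψ (I ∘ π) = momentAdjoint ν k Ψ I := by
  have h : ∀ x ξ t, adjointIntegrand k Ψ (I ∘ π) x ξ t = adjointIntegrand k Ψ I x ξ t := by
    intro x ξ t
    simp only [adjointIntegrand, Function.comp_apply]
    rw [Equiv.prod_comp π fun j => ((ξ (I j) : ℝ) : ℂ)]
  refine Subtype.ext (funext fun x => ?_)
  simp only [momentAdjoint, h]

/-- On the unit sphere, contracting two indices of the adjoint transform lowers its rank. -/
theorem sum_momentAdjoint_append {n p : ℕ} (k : ℕ) (Ψ : TestFunction n) (I : Fin p → Fin n) :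
    ∑ a, momentAdjoint (sphereMeasure n) k Ψ (Fin.append I ![a, a]) =
      momentAdjoint (sphereMeasure n) k Ψ I := by
  have h : ∀ x ξ t a, adjointIntegrand k Ψ (Fin.append I ![a, a]) x ξ t =
      ((ξ a : ℝ) : ℂ) ^ 2 * adjointIntegrand k Ψ I x ξ t := by
    intro x ξ t a
    simp only [adjointIntegrand, Fin.prod_univ_add, Fin.append_left, Fin.append_right,
      Fin.prod_univ_two, Matrix.cons_val_zero, Matrix.cons_val_one]
    ring
  refine Subtype.ext (funext fun x => ?_)
  have hint : ∀ a : Fin n, Integrable (fun ξ =>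
      ((ξ a : ℝ) : ℂ) ^ 2 * ∫ t, adjointIntegrand k Ψ I x ξ t) (sphereMeasure n) := by
    intro a
    have := integrable_integral_adjointIntegrand (sphereMeasure n) k Ψ (Fin.append I ![a, a]) x
    simpa only [h, integral_const_mul] using this
  simp only [momentAdjoint, Submodule.coe_sum, Finset.sum_apply, h, integral_const_mul]
  rw [← integral_finsetSum _ fun a _ => hint a]
  refine integral_congr_ae ?_
  filter_upwards [ae_norm_eq_one n] with ξ hξ
  have h1 : ∑ a, ((ξ a : ℝ) : ℂ) ^ 2 = 1 := by
    have := EuclideanSpace.real_norm_sq_eq ξ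
    rw [hξ, one_pow] at this
    exact_mod_cast this.symm
  rw [← Finset.sum_mul, h1, one_mul]

/-- The pairing of a symmetric tensor field with the adjoint transform of `Ψ`. -/
def tensorPairing {n p : ℕ} (k : ℕ) (Ψ : TestFunction n) : SymTensor n p →ₗ[ℂ] ℂ where
  toFun f := ∑ I : Fin p → Fin n, (f.1 I).1 (momentAdjoint (sphereMeasure n) k Ψ I)
  map_add' f g := by
    simp only [Submodule.coe_add, Pi.add_apply, LinearMap.add_apply, Finset.sum_add_distrib]
  map_smul' c f := by
    simp only [Submodule.coe_smul, Pi.smul_apply, LinearMap.smul_apply, smul_eq_mul,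
      Finset.mul_sum, RingHom.id_apply]

/-- The adjoint transform is symmetric in its indices, so every permutation in the average
contributes the same as the identity. There the Kronecker delta contracts the last two indices,
which produces the factor |ξ|² = 1. -/
theorem tensorPairing_iDelta {n p : ℕ} (k : ℕ) (Ψ : TestFunction n) (f : SymTensor n p) :
    tensorPairing k Ψ (iDelta f) = tensorPairing k Ψ f := by
  let A : ∀ {q : ℕ}, (Fin q → Fin n) → Smooth n := fun I => momentAdjoint (sphereMeasure n) k Ψ I
  let c : (Fin (p + 2) → Fin n) → CompactDistribution n := fun J =>
    if J (Fin.natAdd p 0) = J (Fin.natAdd p 1) then f.1 fun j => J (Fin.castAdd 2 j) else 0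
  have h1 : ∀ I, ((iDelta f).1 I).1 (A I) =
      ((p + 2).factorial : ℂ)⁻¹ * ∑ π : Equiv.Perm (Fin (p + 2)), (c (I ∘ π)).1 (A I) := by
    intro I
    simp only [iDelta, Submodule.coe_smul, Submodule.coe_sum, LinearMap.smul_apply,
      LinearMap.sum_apply, smul_eq_mul]
    rfl
  have h2 : ∀ π : Equiv.Perm (Fin (p + 2)),
      ∑ I : Fin (p + 2) → Fin n, (c (I ∘ π)).1 (A I) = ∑ J, (c J).1 (A J) := by
    intro π
    refine Fintype.sum_equiv (Equiv.arrowCongr π.symm (Equiv.refl _)) _ _ fun I => ?_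
    have h3 : (Equiv.arrowCongr π.symm (Equiv.refl (Fin n))) I = I ∘ π := rfl
    rw [h3]
    exact congrArg _ (momentAdjoint_comp_perm _ k Ψ I π).symm
  have h4 : ∑ J, (c J).1 (A J) = ∑ I, (f.1 I).1 (A I) := by
    rw [← (Fin.appendEquiv p 2).sum_comp, Fintype.sum_prod_type]
    refine Finset.sum_congr rfl fun I _ => ?_
    rw [← (finTwoArrowEquiv (Fin n)).symm.sum_comp, Fintype.sum_prod_type]
    have h5 : ∀ a b, (c (Fin.append I ![a, b])).1 (A (Fin.append I ![a, b])) =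
        if a = b then (f.1 I).1 (A (Fin.append I ![a, a])) else 0 := by
      intro a b
      simp only [c, Fin.append_left, Fin.append_right, Matrix.cons_val_zero,
        Matrix.cons_val_one]
      split_ifs with hab
      · rw [hab]
      · rfl
    calc _ = ∑ a, ∑ b, (c (Fin.append I ![a, b])).1 (A (Fin.append I ![a, b])) := rfl
      _ = ∑ a, (f.1 I).1 (A (Fin.append I ![a, a])) := by
        simp only [h5, Finset.sum_ite_eq, Finset.mem_univ, if_true]
      _ = (f.1 I).1 (A I) := by
        rw [← map_sum]
        exact congrArg _ (sum_momentAdjoint_append k Ψ I)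
  change ∑ I, ((iDelta f).1 I).1 (A I) = ∑ I, (f.1 I).1 (A I)
  simp only [h1]
  rw [← Finset.mul_sum, Finset.sum_comm, Finset.sum_congr rfl fun π _ => h2 π, Finset.sum_const,
    h4, Finset.card_univ, Fintype.card_perm, Fintype.card_fin, nsmul_eq_mul, ← mul_assoc,
    inv_mul_cancel₀ (Nat.cast_ne_zero.2 (Nat.factorial_ne_zero _)), one_mul]

theorem tensorPairing_iDeltaPow {n p : ℕ} (k : ℕ) (Ψ : TestFunction n) (j : ℕ)
    (f : SymTensor n p) : tensorPairing k Ψ (iDeltaPow j f) = tensorPairing k Ψ f := by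
  induction j with
  | zero => rfl
  | succ j ih => exact (tensorPairing_iDelta k Ψ (iDeltaPow j f)).trans ih

theorem tensorPairing_iDeltaPowTo {n p q : ℕ} (k : ℕ) (Ψ : TestFunction n) (j : ℕ)
    (h : p + 2 * j = q) (f : SymTensor n p) :
    tensorPairing k Ψ (iDeltaPowTo j h f) = tensorPairing k Ψ f := by
  subst h
  exact tensorPairing_iDeltaPow k Ψ j f

/-- The even part of `F` on the unit sphere, as a tensor field of a single rank. -/
def evenPart {n m : ℕ} (F : TensorSum n m) : SymTensor n (2 * (m / 2)) :=
  F ⟨2 * (m / 2), by omega⟩ +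
    ∑ l : Fin (m / 2), iDeltaPowTo (m / 2 - l) (by simp only; omega) (F ⟨2 * l, by omega⟩)

/-- The odd part of `F` on the unit sphere, as a tensor field of a single rank. -/
def oddPart {n m : ℕ} (hm : 1 ≤ m) (F : TensorSum n m) : SymTensor n (2 * ((m - 1) / 2) + 1) :=
  F ⟨2 * ((m - 1) / 2) + 1, by omega⟩ +
    ∑ l : Fin ((m - 1) / 2),
      iDeltaPowTo ((m - 1) / 2 - l) (by simp only; omega) (F ⟨2 * l + 1, by omega⟩)

theorem evenRelation_iff {n m : ℕ} (F : TensorSum n m) : EvenRelation F ↔ evenPart F = 0 := by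
  unfold EvenRelation evenPart
  exact eq_neg_iff_add_eq_zero (G := SymTensor n (2 * (m / 2)))

theorem oddRelation_iff {n m : ℕ} (hm : 1 ≤ m) (F : TensorSum n m) :
    OddRelation hm F ↔ oddPart hm F = 0 := by
  unfold OddRelation oddPart
  exact eq_neg_iff_add_eq_zero (G := SymTensor n (2 * ((m - 1) / 2) + 1))

theorem sum_range_even_add_odd {M : Type*} [AddCommMonoid M] (G : ℕ → M) (m : ℕ) :
    ∑ q ∈ Finset.range (m + 1), G q = ∑ l ∈ Finset.range (m / 2 + 1), G (2 * l) +
      ∑ l ∈ Finset.range ((m + 1) / 2), G (2 * l + 1) := by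
  induction m with
  | zero => simp
  | succ m ih =>
    rw [Finset.sum_range_succ, ih]
    rcases Nat.even_or_odd' m with ⟨r, rfl | rfl⟩
    · rw [show (2 * r + 1) / 2 = r by omega, show 2 * r / 2 = r by omega,
        show (2 * r + 1 + 1) / 2 = r + 1 by omega, Finset.sum_range_succ (fun l => G (2 * l + 1)),
        add_assoc]
    · rw [show (2 * r + 1) / 2 = r by omega, show (2 * r + 1 + 1) / 2 = r + 1 by omega,
        show (2 * r + 1 + 1 + 1) / 2 = r + 1 by omega,
        Finset.sum_range_succ (fun l => G (2 * l)) (r + 1), add_right_comm]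
      rfl

/-- Raising a component by powers of `i_δ` does not change its pairing, so all components of one
parity can be moved to a common rank. -/
theorem sphereTransform_eq_evenPart_add_oddPart {n m : ℕ} (hm : 1 ≤ m) (k : ℕ)
    (F : TensorSum n m) (Ψ : TestFunction n) :
    sphereTransform k F Ψ =
      tensorPairing k Ψ (evenPart F) + tensorPairing k Ψ (oddPart hm F) := by
  let G : ℕ → ℂ := fun q => if h : q < m + 1 then tensorPairing k Ψ (F ⟨q, h⟩) else 0
  have hG : ∀ q (h : q < m + 1), tensorPairing k Ψ (F ⟨q, h⟩) = G q := fun q h => by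
    simp only [G, h, dif_pos]
  have h1 : sphereTransform k F Ψ = ∑ q ∈ Finset.range (m + 1), G q := by
    change ∑ p : Fin (m + 1), tensorPairing k Ψ (F p) = _
    rw [Finset.sum_range]
    exact Finset.sum_congr rfl fun q _ => hG q q.2
  -- This identity needs `1 ≤ m`: for `m = 0` there is no odd component, and that case is treated
  -- separately.
  rw [h1, sum_range_even_add_odd, show (m + 1) / 2 = (m - 1) / 2 + 1 by omega,
    Finset.sum_range_succ, Finset.sum_range_succ, Finset.sum_range, Finset.sum_range]
  simp only [evenPart, oddPart, map_add, map_sum, tensorPairing_iDeltaPowTo, hG]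
  rw [add_comm (G (2 * (m / 2))), add_comm (G (2 * ((m - 1) / 2) + 1))]

/-! ### Wave test functions -/

/-- The component of `x` orthogonal to a unit vector `ξ`. -/
def perp {n : ℕ} (ξ x : Euc n) : Euc n := x - (inner ℝ x ξ : ℝ) • ξ

theorem contDiff_perp {n : ℕ} : ContDiff ℝ ∞ fun q : Euc n × Euc n => perp q.1 q.2 :=
  contDiff_snd.sub ((contDiff_snd.inner ℝ contDiff_fst).smul contDiff_fst)

/-- This makes the cut-off wave constant along each line of direction ξ. -/
theorem perp_sub_smul {n : ℕ} {ξ : Euc n} (hξ : ‖ξ‖ = 1) (x : Euc n) (t : ℝ) :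
    perp ξ (x - t • ξ) = perp ξ x := by
  simp only [perp, inner_sub_left, inner_smul_left, real_inner_self_eq_norm_sq, hξ, conj_trivial,
    one_pow, mul_one, sub_smul]
  abel

theorem norm_perp_le {n : ℕ} {ξ : Euc n} (hξ : ‖ξ‖ = 1) (x : Euc n) : ‖perp ξ x‖ ≤ 2 * ‖x‖ := by
  have h1 : ‖(inner ℝ x ξ : ℝ) • ξ‖ ≤ ‖x‖ := by
    rw [norm_smul, hξ, mul_one]
    simpa [hξ] using norm_inner_le_norm (𝕜 := ℝ) x ξ
  have := norm_sub_le x ((inner ℝ x ξ : ℝ) • ξ)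
  unfold perp
  linarith

/-- A cut-off plane wave on the hyperplane orthogonal to `ξ`. -/
def cutoffWave {n : ℕ} (χ : ContDiffBump (0 : Euc n)) (y : Euc n) (q : Euc n × Euc n) : ℂ :=
  (χ (perp q.1 q.2) : ℂ) * Complex.exp (Complex.I * (inner ℝ (perp q.1 q.2) y : ℝ))

theorem contDiff_cutoffWave {n : ℕ} (χ : ContDiffBump (0 : Euc n)) (y : Euc n) :
    ContDiff ℝ ∞ (cutoffWave χ y) :=
  (Complex.ofRealCLM.contDiff.comp (χ.contDiff.comp contDiff_perp)).mul
    (contDiff_const.mul (contDiff_inner_ofReal contDiff_perp contDiff_const)).cexp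

theorem contDiff_pow_mul_cutoffWave {n : ℕ} (k : ℕ) (χ : ContDiffBump (0 : Euc n)) (y : Euc n) :
    ContDiff ℝ ∞ fun q : Euc n × Euc n =>
      ((inner ℝ q.2 q.1 : ℝ) : ℂ) ^ k * cutoffWave χ y q :=
  ((contDiff_inner_ofReal contDiff_snd contDiff_fst).pow k).mul (contDiff_cutoffWave χ y)

/-- The test function `α(ξ) ρ(x ⬝ ξ) χ(z) exp (i z ⬝ y)`, with `z` the component of `x`
orthogonal to `ξ`. -/
def waveTest {n : ℕ} (χ : ContDiffBump (0 : Euc n)) (y : Euc n) {α : Euc n → ℝ}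
    (hα : ContDiff ℝ ∞ α) (hαc : HasCompactSupport α) (hα0 : tsupport α ⊆ {0}ᶜ) {ρ : ℝ → ℝ}
    (hρ : ContDiff ℝ ∞ ρ) (hρc : HasCompactSupport ρ) : TestFunction n where
  toFun q := (α q.2 : ℂ) * (ρ (inner ℝ q.1 q.2) : ℂ) * cutoffWave χ y (q.2, q.1)
  smooth := ((Complex.ofRealCLM.contDiff.comp (hα.comp contDiff_snd)).mul
    (Complex.ofRealCLM.contDiff.comp (hρ.comp (contDiff_fst.inner ℝ contDiff_snd)))).mul
    ((contDiff_cutoffWave χ y).comp (contDiff_snd.prodMk contDiff_fst))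
  compact := by
    obtain ⟨A, hA⟩ := hαc.isBounded.exists_norm_le
    obtain ⟨B, hB⟩ := hρc.isBounded.exists_norm_le
    refine HasCompactSupport.intro ((isCompact_closedBall (0 : Euc n) (χ.rOut + B * A)).prod
      (isCompact_closedBall (0 : Euc n) A)) fun q hq => ?_
    by_contra hne
    refine hq ?_
    have h1 : α q.2 ≠ 0 := fun h => hne (by simp [h])
    have h2 : ρ (inner ℝ q.1 q.2) ≠ 0 := fun h => hne (by simp [h])
    have h3 : χ (perp q.2 q.1) ≠ 0 := fun h => hne (by simp [cutoffWave, h])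
    have h4 := hA _ (subset_tsupport _ h1)
    have h5 := hB _ (subset_tsupport _ h2)
    have h6 : ‖perp q.2 q.1‖ ≤ χ.rOut := by
      by_contra! hlt
      exact h3 (χ.zero_of_le_dist (by simpa using hlt.le))
    refine ⟨?_, by simpa using h4⟩
    rw [mem_closedBall_zero_iff]
    have h7 : q.1 = perp q.2 q.1 + (inner ℝ q.1 q.2 : ℝ) • q.2 := by simp [perp]
    rw [h7]
    refine (norm_add_le _ _).trans (add_le_add h6 ?_)
    rw [norm_smul]
    exact mul_le_mul h5 h4 (norm_nonneg _) ((norm_nonneg _).trans h5)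
  support_ne := by
    intro q hq
    have hcl : IsClosed {q : Euc n × Euc n | q.2 ∈ tsupport α} :=
      (isClosed_tsupport α).preimage continuous_snd
    have hsub : tsupport (fun q : Euc n × Euc n =>
        (α q.2 : ℂ) * (ρ (inner ℝ q.1 q.2) : ℂ) * cutoffWave χ y (q.2, q.1)) ⊆
          {q : Euc n × Euc n | q.2 ∈ tsupport α} := by
      refine closure_minimal (fun q hq => subset_tsupport _ fun h => hq ?_) hcl
      simp [h]
    exact hα0 (hsub hq)

/-- Along the line everything but `t ^ m` and `ρ` is constant, so the integral is the convolution in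
`hρm` at `s = inner ℝ x ξ`. -/
theorem integral_adjointIntegrand_waveTest {n p k m : ℕ} (χ : ContDiffBump (0 : Euc n))
    (y : Euc n) {α : Euc n → ℝ} (hα : ContDiff ℝ ∞ α) (hαc : HasCompactSupport α)
    (hα0 : tsupport α ⊆ {0}ᶜ) {ρ : ℝ → ℝ} (hρ : ContDiff ℝ ∞ ρ) (hρc : HasCompactSupport ρ)
    (hρm : ∀ s : ℝ, ∫ t : ℝ, (t : ℂ) ^ m * (ρ (s - t) : ℂ) = (s : ℂ) ^ k) (I : Fin p → Fin n)
    (x : Euc n) {ξ : Euc n} (hξ : ‖ξ‖ = 1) :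
    ∫ t, adjointIntegrand m (waveTest χ y hα hαc hα0 hρ hρc) I x ξ t =
      (α ξ : ℂ) * (∏ j, (ξ (I j) : ℂ)) *
        (((inner ℝ x ξ : ℝ) : ℂ) ^ k * cutoffWave χ y (ξ, x)) := by
  rw [← hρm, ← integral_mul_const, ← integral_const_mul]
  refine integral_congr_ae (Filter.Eventually.of_forall fun t => ?_)
  have h1 : inner ℝ (x - t • ξ) ξ = inner ℝ x ξ - t := by
    rw [inner_sub_left, inner_smul_left, real_inner_self_eq_norm_sq, hξ]
    simp
  simp only [adjointIntegrand, waveTest, cutoffWave, perp_sub_smul hξ, h1]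
  ring

/-- The pairing of a tensor field with a wave test function, as an integral over the sphere. -/
theorem tensorPairing_waveTest {n p k m : ℕ} (χ : ContDiffBump (0 : Euc n))
    (y : Euc n) {α : Euc n → ℝ} (hα : ContDiff ℝ ∞ α) (hαc : HasCompactSupport α)
    (hα0 : tsupport α ⊆ {0}ᶜ) {ρ : ℝ → ℝ} (hρ : ContDiff ℝ ∞ ρ) (hρc : HasCompactSupport ρ)
    (hρm : ∀ s : ℝ, ∫ t : ℝ, (t : ℂ) ^ m * (ρ (s - t) : ℂ) = (s : ℂ) ^ k)
    (f : SymTensor n p) :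
    tensorPairing m (waveTest χ y hα hαc hα0 hρ hρc) f =
      ∫ ξ, α ξ • ∑ I, (∏ j, (ξ (I j) : ℂ)) *
        (f.1 I).1 (slice (contDiff_pow_mul_cutoffWave k χ y) ξ) ∂(sphereMeasure n) := by
  have hcoef : ∀ I : Fin p → Fin n,
      ContDiff ℝ ∞ fun ξ : Euc n => (α ξ : ℂ) * ∏ j, (ξ (I j) : ℂ) := fun I =>
    (Complex.ofRealCLM.contDiff.comp hα).mul (contDiff_prod fun j _ =>
      Complex.ofRealCLM.contDiff.comp (EuclideanSpace.proj (I j) : Euc n →L[ℝ] ℝ).contDiff)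
  have hΦ : ∀ I : Fin p → Fin n, ContDiff ℝ ∞ fun q : Euc n × Euc n =>
      (α q.1 : ℂ) * (∏ j, (q.1 (I j) : ℂ)) *
        (((inner ℝ q.2 q.1 : ℝ) : ℂ) ^ k * cutoffWave χ y q) := fun I =>
    ((hcoef I).comp contDiff_fst).mul (contDiff_pow_mul_cutoffWave k χ y)
  have hslice : ∀ (I : Fin p → Fin n) (ξ : Euc n), slice (hΦ I) ξ =
      ((α ξ : ℂ) * ∏ j, (ξ (I j) : ℂ)) • slice (contDiff_pow_mul_cutoffWave k χ y) ξ :=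
    fun I ξ => rfl
  have hterm : ∀ I : Fin p → Fin n,
      (f.1 I).1 (momentAdjoint (sphereMeasure n) m (waveTest χ y hα hαc hα0 hρ hρc) I) =
      ∫ ξ, (α ξ : ℂ) * (∏ j, (ξ (I j) : ℂ)) *
        (f.1 I).1 (slice (contDiff_pow_mul_cutoffWave k χ y) ξ) ∂(sphereMeasure n) := by
    intro I
    rw [pairing_integral_slice (f.1 I) (sphereMeasure n) (hΦ I) hαc
      (fun ξ hξ x => by simp [image_eq_zero_of_notMem_tsupport hξ])]
    · simp only [hslice, map_smul, smul_eq_mul]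
    · intro x
      refine integral_congr_ae ?_
      filter_upwards [ae_norm_eq_one n] with ξ hξ
      exact integral_adjointIntegrand_waveTest χ y hα hαc hα0 hρ hρc hρm I x hξ
  have hint : ∀ I : Fin p → Fin n, Integrable (fun ξ => (α ξ : ℂ) * (∏ j, (ξ (I j) : ℂ)) *
      (f.1 I).1 (slice (contDiff_pow_mul_cutoffWave k χ y) ξ)) (sphereMeasure n) := by
    intro I
    refine ((hcoef I).continuous.mul
      (continuous_pairing_slice _ _)).integrable_of_hasCompactSupport ?_
    exact HasCompactSupport.intro hαc fun ξ hξ => by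
      simp [image_eq_zero_of_notMem_tsupport hξ]
  change ∑ I, (f.1 I).1 _ = _
  rw [Finset.sum_congr rfl fun I _ => hterm I, ← integral_finsetSum _ fun I _ => hint I]
  refine integral_congr_ae (Filter.Eventually.of_forall fun ξ => ?_)
  simp only [Complex.real_smul, Finset.mul_sum, mul_assoc]

/-! ### Localisation to one direction and separation of parities -/

/-- A continuous function that is orthogonal to all test functions on the sphere vanishes on the
sphere. -/
theorem eq_zero_on_sphere_of_integral_smul_eq_zero {n : ℕ} {B : Euc n → ℂ} (hB : Continuous B)
    (h : ∀ α : Euc n → ℝ, ContDiff ℝ ∞ α → HasCompactSupport α → tsupport α ⊆ {0}ᶜ →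
      ∫ ξ, α ξ • B ξ ∂(sphereMeasure n) = 0) {ξ : Euc n} (hξ : ‖ξ‖ = 1) : B ξ = 0 := by
  have h1 := isOpen_compl_singleton.ae_eq_zero_of_integral_contDiff_smul_eq_zero
    ((hB.locallyIntegrable (μ := sphereMeasure n)).locallyIntegrableOn _) h
  have h2 : ∀ᵐ ξ ∂(sphereMeasure n), B ξ = 0 := by
    filter_upwards [h1, ae_norm_eq_one n] with ξ h3 h4
    refine h3 fun h0 => ?_
    rw [Set.mem_singleton_iff.1 h0, norm_zero] at h4
    exact zero_ne_one h4
  unfold sphereMeasure at h2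
  have h3 := ae_of_ae_map measurable_subtype_coe.aemeasurable h2
  -- Surface measure charges every nonempty open subset of the sphere, so continuity upgrades almost
  -- everywhere to everywhere.
  have h4 : (fun θ : Metric.sphere (0 : Euc n) 1 => B θ) = fun _ => 0 :=
    ((hB.comp continuous_subtype_val).ae_eq_iff_eq
      (volume : Measure (Euc n)).toSphere continuous_const).1 h3
  exact congrFun h4 ⟨ξ, by simpa using hξ⟩

theorem exists_radius {n p : ℕ} (f : SymTensor n p) : ∃ R : ℝ, ∀ I, ∀ φ ψ : Smooth n,
    (∀ x, ‖x‖ < R → φ.1 x = ψ.1 x) → (f.1 I).1 φ = (f.1 I).1 ψ := by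
  choose R hR using fun I => exists_pairing_eq_of_eqOn_ball (f.1 I)
  obtain ⟨M, hM⟩ := Finite.exists_le R
  exact ⟨M, fun I φ ψ h => hR I φ ψ fun x hx => h x (hx.trans_le (hM I))⟩

/-- For y ⊥ ξ the wave does not see the component of x along ξ. The factor 2 in `hχ` matches the
crude bound `norm_perp_le`. -/
theorem slice_cutoffWave_eq_rayWave {n k : ℕ} {χ : ContDiffBump (0 : Euc n)} {R : ℝ}
    (hχ : 2 * R ≤ χ.rIn) {y ξ : Euc n} (hξ : ‖ξ‖ = 1) (hξy : inner ℝ ξ y = 0) {x : Euc n}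
    (hx : ‖x‖ < R) :
    (slice (contDiff_pow_mul_cutoffWave k χ y) ξ).1 x = (rayWave k ξ y).1 x := by
  have h1 : χ (perp ξ x) = 1 := χ.one_of_mem_closedBall (by
    rw [mem_closedBall_zero_iff]
    linarith [norm_perp_le hξ x])
  have h2 : inner ℝ (perp ξ x) y = inner ℝ x y := by
    rw [perp, inner_sub_left, inner_smul_left, hξy, mul_zero, sub_zero]
  simp only [slice, cutoffWave, rayWave, h1, h2, Complex.ofReal_one, one_mul]

/-- Reversing ξ yields p signs from the tensor and k from the wave; for equal k this distinguishes
even from odd rank. -/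
theorem form_rayWave_neg {n p : ℕ} (k : ℕ) (f : SymTensor n p) (ξ y : Euc n) :
    ∑ I, (∏ j, (((-ξ) (I j) : ℝ) : ℂ)) * (f.1 I).1 (rayWave k (-ξ) y) =
      (-1) ^ (p + k) * ∑ I, (∏ j, (ξ (I j) : ℂ)) * (f.1 I).1 (rayWave k ξ y) := by
  rw [Finset.mul_sum]
  refine Finset.sum_congr rfl fun I _ => ?_
  have h : rayWave k (-ξ) y = ((-1 : ℂ) ^ k) • rayWave k ξ y := by
    have := rayWave_smul k (-1) ξ y
    rw [neg_one_smul] at this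
    rw [this]
    norm_num
  rw [h, map_smul, smul_eq_mul, pow_add]
  simp only [PiLp.neg_apply, Complex.ofReal_neg, Finset.prod_neg, Finset.card_univ,
    Fintype.card_fin]
  ring

/-- An even and an odd tensor field of rank at most `m` whose `m`-th momentum ray transforms
cancel on the sphere bundle both vanish. -/
theorem eq_zero_of_tensorPairing_add_eq_zero {n m p q : ℕ} (hn : 2 ≤ n) (hpe : Even p) (hqo : Odd q)
    (e : SymTensor n p) (o : SymTensor n q)
    (h : ∀ Ψ : TestFunction n, tensorPairing m Ψ e + tensorPairing m Ψ o = 0) :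
    (p ≤ m → e = 0) ∧ (q ≤ m → o = 0) := by
  obtain ⟨R₁, hR₁⟩ := exists_radius e
  obtain ⟨R₂, hR₂⟩ := exists_radius o
  let r : ℝ := max (2 * max R₁ R₂) 1
  let χ : ContDiffBump (0 : Euc n) := ⟨r, r + 1, by positivity, by linarith⟩
  have hχ₁ : 2 * R₁ ≤ χ.rIn :=
    (mul_le_mul_of_nonneg_left (le_max_left R₁ R₂) zero_le_two).trans (le_max_left _ _)
  have hχ₂ : 2 * R₂ ≤ χ.rIn :=
    (mul_le_mul_of_nonneg_left (le_max_right R₁ R₂) zero_le_two).trans (le_max_left _ _)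
  have hsum : ∀ ξ y : Euc n, ‖ξ‖ = 1 → inner ℝ ξ y = 0 → ∀ k ≤ m,
      ∑ I, (∏ j, (ξ (I j) : ℂ)) * (e.1 I).1 (rayWave k ξ y) +
        ∑ I, (∏ j, (ξ (I j) : ℂ)) * (o.1 I).1 (rayWave k ξ y) = 0 := by
    intro ξ y hξ hξy k hk
    obtain ⟨ρ, hρ, hρc, hρm⟩ := exists_bump_convolution_pow hk
    have hcont : ∀ {p : ℕ} (f : SymTensor n p), Continuous fun ξ : Euc n =>
        ∑ I, (∏ j, (ξ (I j) : ℂ)) *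
          (f.1 I).1 (slice (contDiff_pow_mul_cutoffWave k χ y) ξ) := fun f =>
      continuous_finsetSum _ fun I _ => Continuous.mul (by fun_prop)
        (continuous_pairing_slice _ _)
    have h1 := eq_zero_on_sphere_of_integral_smul_eq_zero ((hcont e).add (hcont o))
      (fun α hα hαc hα0 => by
        have h2 := h (waveTest χ y hα hαc hα0 hρ hρc)
        rw [tensorPairing_waveTest χ y hα hαc hα0 hρ hρc hρm,
          tensorPairing_waveTest χ y hα hαc hα0 hρ hρc hρm, ← integral_add] at h2
        · simpa only [Pi.add_apply, smul_add] using h2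
        · exact (hα.continuous.smul (hcont e)).integrable_of_hasCompactSupport hαc.smul_right
        · exact (hα.continuous.smul (hcont o)).integrable_of_hasCompactSupport hαc.smul_right)
      hξ
    have he : ∀ I, (e.1 I).1 (slice (contDiff_pow_mul_cutoffWave k χ y) ξ) =
        (e.1 I).1 (rayWave k ξ y) := fun I =>
      hR₁ I _ _ fun x hx => slice_cutoffWave_eq_rayWave hχ₁ hξ hξy hx
    have ho : ∀ I, (o.1 I).1 (slice (contDiff_pow_mul_cutoffWave k χ y) ξ) =
        (o.1 I).1 (rayWave k ξ y) := fun I =>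
      hR₂ I _ _ fun x hx => slice_cutoffWave_eq_rayWave hχ₂ hξ hξy hx
    simpa only [Pi.add_apply, he, ho] using h1
  -- This is `hsum` at -ξ after cancelling `(-1) ^ k`: the even term keeps its sign and the odd one
  -- changes it.
  have hneg : ∀ ξ y : Euc n, ‖ξ‖ = 1 → inner ℝ ξ y = 0 → ∀ k ≤ m,
      ∑ I, (∏ j, (ξ (I j) : ℂ)) * (e.1 I).1 (rayWave k ξ y) -
        ∑ I, (∏ j, (ξ (I j) : ℂ)) * (o.1 I).1 (rayWave k ξ y) = 0 := by
    intro ξ y hξ hξy k hk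
    have h1 := hsum (-ξ) y (by rwa [norm_neg]) (by rw [inner_neg_left, hξy, neg_zero]) k hk
    rw [form_rayWave_neg, form_rayWave_neg, pow_add, pow_add, hpe.neg_one_pow,
      hqo.neg_one_pow] at h1
    have h2 : (-1 : ℂ) ^ k ≠ 0 := pow_ne_zero _ (by norm_num)
    refine (mul_eq_zero.1 (?_ : (-1 : ℂ) ^ k * _ = 0)).resolve_left h2
    rw [← h1]
    ring
  refine ⟨fun hp => symTensor_eq_zero_of_rayWave hn hp e fun ξ y hξ hξy k hk => ?_,
    fun hq => symTensor_eq_zero_of_rayWave hn hq o fun ξ y hξ hξy k hk => ?_⟩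
  · linear_combination (hsum ξ y hξ hξy k hk + hneg ξ y hξ hξy k hk) / 2
  · linear_combination (hsum ξ y hξ hξy k hk - hneg ξ y hξ hξy k hk) / 2

/-! ### Conclusion of the equivalences -/

theorem sphereTransform_eq_zero_of_parts {n m : ℕ} (hm : 1 ≤ m) {F : TensorSum n m}
    (he : evenPart F = 0) (ho : oddPart hm F = 0) (k : ℕ) : sphereTransform k F = 0 := by
  funext Ψ
  rw [sphereTransform_eq_evenPart_add_oddPart hm, he, ho, map_zero, map_zero, add_zero,
    Pi.zero_apply]

theorem parts_eq_zero_of_sphereTransform {n m : ℕ} (hn : 2 ≤ n) (hm : 1 ≤ m) {F : TensorSum n m}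
    (h : sphereTransform m F = 0) : evenPart F = 0 ∧ oddPart hm F = 0 := by
  have h1 := eq_zero_of_tensorPairing_add_eq_zero hn (even_two_mul _) (odd_two_mul_add_one _)
    (evenPart F) (oddPart hm F) fun Ψ => by
      rw [← sphereTransform_eq_evenPart_add_oddPart hm, h, Pi.zero_apply]
  exact ⟨h1.1 (by omega), h1.2 (by omega)⟩

theorem sphereTransform_zero {n m : ℕ} (k : ℕ) :
    sphereTransform k (0 : TensorSum n m) = 0 := by
  funext Ψ
  simp [sphereTransform, momentRayTransform]

theorem eq_zero_of_sphereTransform_of_le_one {n m : ℕ} (hn : 2 ≤ n) (hm : m ≤ 1)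
    {F : TensorSum n m} (h : sphereTransform m F = 0) : F = 0 := by
  obtain rfl | rfl : m = 0 ∨ m = 1 := by omega
  · funext p
    obtain rfl : p = 0 := Fin.fin_one_eq_zero p
    -- The zero field of rank 1 stands in for the missing odd part; its rank exceeds `m = 0`, but
    -- only the half about the even field is used.
    refine (eq_zero_of_tensorPairing_add_eq_zero hn (p := 0) Even.zero odd_one (F 0)
      (0 : SymTensor n 1) fun Ψ => ?_).1 le_rfl
    rw [map_zero, add_zero]
    have h1 : sphereTransform 0 F Ψ = ∑ p : Fin 1, tensorPairing 0 Ψ (F p) := rfl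
    rw [Fin.sum_univ_one, h] at h1
    exact h1.symm
  · obtain ⟨he, ho⟩ := parts_eq_zero_of_sphereTransform hn le_rfl h
    funext p
    fin_cases p
    -- For `m = 1` the sums in both parts are empty, so the parts are the components of `F`
    -- themselves.
    · exact (add_zero (F 0)).symm.trans he
    · exact (add_zero (F 1)).symm.trans ho

end MRT

end

theorem mainTheorem6 (n m : ℕ) (hn : 2 ≤ n) (F : MRT.TensorSum n m) :
    (∀ hm : 2 ≤ m,
      List.TFAE [
        MRT.sphereTransform m F = 0,
        ∀ k ≤ m, MRT.sphereTransform k F = 0,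
        MRT.EvenRelation F ∧ MRT.OddRelation (one_le_two.trans hm) F]) ∧
    (m ≤ 1 →
      List.TFAE [
        MRT.sphereTransform m F = 0,
        ∀ k ≤ m, MRT.sphereTransform k F = 0,
        F = 0]) := by
  refine ⟨fun hm => ?_, fun hm => ?_⟩
  · rw [MRT.evenRelation_iff, MRT.oddRelation_iff]
    tfae_have 1 → 3 := MRT.parts_eq_zero_of_sphereTransform hn _
    tfae_have 3 → 2 := fun h k _ => MRT.sphereTransform_eq_zero_of_parts _ h.1 h.2 k
    tfae_have 2 → 1 := fun h => h m le_rfl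
    tfae_finish
  · tfae_have 1 → 3 := MRT.eq_zero_of_sphereTransform_of_le_one hn hm
    tfae_have 3 → 2 := fun h k _ => h ▸ MRT.sphereTransform_zero k
    tfae_have 2 → 1 := fun h => h m le_rfl
    tfae_finish
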